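/- Let $\mathfrak C$ be a monster model of a complete (possibly many-sorted) first-order theory $T$: for some uncountable strong limit cardinal $\kappa$ larger than the number of sorts and symbols of the language, $\mathfrak C$ is $\kappa$-saturated and strongly $\kappa$-homogeneous. "Small" and "bounded" mean of size less than $\kappa$. A subset of a small product of sorts is type-definable over $A$ if it is an intersection of a small number of subsets definable over $A$, and type-definable if this holds for some small set of parameters $A$. On each small product of sorts let $\equiv_L$ be the finest bounded $\operatorname{Aut}(\mathfrak C)$-invariant equivalence relation; let $\operatorname{Aut\,f}_L(\mathfrak C)$ be the normal subgroup of the automorphisms that preserve all $\equiv_L$-classes of small tuples, and put $\operatorname{Gal}(T)=\operatorname{Aut}(\mathfrak C)/\operatorname{Aut\,f}_L(\mathfrak C)$. If $E$ is a bounded invariant equivalence relation on a type-definable set $X$, the logic topology on $X/E$ is the one whose closed sets are exactly the sets with type-definable preimage in $X$. Let $m$ be a small tuple enumerating an elementary submodel of $\mathfrak C$; $\operatorname{Gal}(T)$ carries the topology obtained from the logic topology on $[m]_{\equiv}/{\equiv_L}$ through the bijection $\sigma\operatorname{Aut\,f}_L(\mathfrak C)\mapsto[\sigma(m)]_{\equiv_L}$,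 where $[m]_\equiv$ is the set of tuples with the same type over $\emptyset$ as $m$. Theorem. Let $X$ be a $\emptyset$-type-definable subset of a small product of sorts of $\mathfrak C$, and let $E$ be a bounded, $\operatorname{Aut}(\mathfrak C)$-invariant equivalence relation on $X$ which is orbital, i.e. there is a subgroup $\Gamma\le\operatorname{Aut}(\mathfrak C)$ with $E=E_\Gamma$, where $E_\Gamma$ is the relation on $X$ of lying in the same $\Gamma$-orbit. Let $\Gamma_E$ be the group of all $\sigma\in\operatorname{Aut}(\mathfrak C)$ that preserve every $E$-class setwise. Then the following are equivalent: 1. $E$ is type-definable; 2. each $E$-class is type-definable; 3. $\Gamma_E$ is the preimage in $\operatorname{Aut}(\mathfrak C)$ of a closed subgroup of $\operatorname{Gal}(T)$; 4. $E=E_\Gamma$ for some $\Gamma\le\operatorname{Aut}(\mathfrak C)$ which is the preimage of a closed subgroup of $\operatorname{Gal}(T)$; 5. $X/E$ with the logic topology is Hausdorff. -/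

import Mathlib

universe u

open Cardinal Topology
open scoped Pointwise

/-! ### Many-sorted first-order logic -/

/-- A many-sorted first-order language: sorts, function symbols and relation symbols,
each symbol with a finite list of argument sorts (and a value sort for functions). -/
structure MSLang : Type (u + 1) where
  Srt : Type u
  Fn : Type u
  Rel : Type u
  fnLen : Fn → ℕ
  fnDom : (f : Fn) → Fin (fnLen f) → Srt
  fnCod : Fn → Srt
  relLen : Rel → ℕ
  relDom : (r : Rel) → Fin (relLen r) → Srt

namespace MSLang

/-- An `L`-structure with universe `M t` in the sort `t`. -/
class Str (L : MSLang.{u}) (M : L.Srt → Type u) where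
  fn : ∀ f : L.Fn, (∀ i, M (L.fnDom f i)) → M (L.fnCod f)
  rel : ∀ r : L.Rel, (∀ i, M (L.relDom r i)) → Prop

section Logic

variable (L : MSLang.{u})

/-- Terms of a given sort; the variable `a` has sort `s a`. -/
inductive Term {α : Type u} (s : α → L.Srt) : L.Srt → Type u
  | var (a : α) : Term s (s a)
  | app (f : L.Fn) (ts : ∀ i, Term s (L.fnDom f i)) : Term s (L.fnCod f)

/-- The sorts of the free variables (in `α`) together with the bound variables (in `Γ`). -/
abbrev ctx {L : MSLang.{u}} {α : Type u} (s : α → L.Srt) (Γ : List L.Srt) :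
    α ⊕ Fin Γ.length → L.Srt :=
  Sum.elim s Γ.get

/-- First-order formulas with free variables `a : α` of sort `s a`, in the scope of
bound variables of the sorts listed in `Γ`. -/
inductive BFormula {α : Type u} (s : α → L.Srt) : List L.Srt → Type u
  | falsum {Γ : List L.Srt} : BFormula s Γ
  | equal {Γ : List L.Srt} {t : L.Srt} (a b : L.Term (ctx s Γ) t) : BFormula s Γ
  | rel {Γ : List L.Srt} (r : L.Rel) (ts : ∀ i, L.Term (ctx s Γ) (L.relDom r i)) : BFormula s Γ
  | imp {Γ : List L.Srt} (φ ψ : BFormula s Γ) : BFormula s Γ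
  | all {Γ : List L.Srt} (t : L.Srt) (φ : BFormula s (t :: Γ)) : BFormula s Γ

/-- Formulas whose free variables are the `a : α`, of sort `s a`. -/
abbrev Formula {α : Type u} (s : α → L.Srt) : Type u := L.BFormula s []

variable {L} {M : L.Srt → Type u} [L.Str M] {α : Type u} {s : α → L.Srt}

/-- The value of a term under an assignment. -/
def Term.eval (v : ∀ a, M (s a)) : {t : L.Srt} → L.Term s t → M t
  | _, .var a => v a
  | _, .app f ts => Str.fn f fun i => (ts i).eval v

/-- The assignment of free and bound variables given by `v` and `xs`. -/
def assign {Γ : List L.Srt} (v : ∀ a, M (s a)) (xs : ∀ i : Fin Γ.length, M (Γ.get i)) :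
    ∀ j, M (ctx s Γ j)
  | .inl a => v a
  | .inr i => xs i

/-- Satisfaction of a formula. -/
def BFormula.Holds (v : ∀ a, M (s a)) :
    {Γ : List L.Srt} → L.BFormula s Γ → (∀ i : Fin Γ.length, M (Γ.get i)) → Prop
  | _, .falsum, _ => False
  | _, .equal a b, xs => a.eval (assign v xs) = b.eval (assign v xs)
  | _, .rel r ts, xs => Str.rel r fun i => (ts i).eval (assign v xs)
  | _, .imp φ ψ, xs => φ.Holds v xs → ψ.Holds v xs
  | Γ, .all t φ, xs => ∀ x : M t, φ.Holds v (Fin.cons (α := fun i => M ((t :: Γ).get i)) x xs)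

/-- `M ⊨ φ(v)`. -/
def Formula.Realize (φ : L.Formula s) (v : ∀ a, M (s a)) : Prop :=
  BFormula.Holds v φ fun i => i.elim0

/-- `≡`: the two tuples have the same type over `∅`. -/
def SameType (a b : ∀ i, M (s i)) : Prop :=
  ∀ φ : L.Formula s, φ.Realize a ↔ φ.Realize b

end Logic

/-! ### Automorphisms -/

section Aut

variable (L : MSLang.{u}) (M : L.Srt → Type u) [L.Str M]

/-- The automorphism group of `M`. -/
def Aut : Subgroup (∀ t, Equiv.Perm (M t)) where
  carrier := {σ | (∀ (f : L.Fn) (xs : ∀ i, M (L.fnDom f i)),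
      σ _ (Str.fn f xs) = Str.fn f fun i => σ _ (xs i)) ∧
    ∀ (r : L.Rel) (xs : ∀ i, M (L.relDom r i)),
      Str.rel r (fun i => σ _ (xs i)) ↔ Str.rel r xs}
  one_mem' := ⟨fun _ _ => rfl, fun _ _ => Iff.rfl⟩
  mul_mem' := by
    rintro σ τ ⟨h1, h2⟩ ⟨k1, k2⟩
    refine ⟨fun f xs => ?_, fun r xs => ?_⟩
    · simp [k1, h1]
    · simpa [k2] using h2 r fun i => τ _ (xs i)
  inv_mem' := by
    rintro σ ⟨h1, h2⟩
    refine ⟨fun f xs => ?_, fun r xs => ?_⟩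
    · change (σ _).symm (Str.fn f xs) = _
      rw [Equiv.symm_apply_eq, h1]
      simp
    · simpa using (h2 r fun i => (σ⁻¹) _ (xs i)).symm

variable {L M}

/-- The action on each sort; the action on products of sorts is the coordinatewise one. -/
instance (t : L.Srt) : MulAction (L.Aut M) (M t) where
  smul σ a := σ.1 t a
  one_smul _ := rfl
  mul_smul _ _ _ := rfl

theorem smul_fn (σ : L.Aut M) (f : L.Fn) (xs : ∀ i, M (L.fnDom f i)) :
    σ • (Str.fn f xs : M (L.fnCod f)) = Str.fn f fun i => σ • xs i :=
  σ.2.1 f xs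

theorem rel_smul (σ : L.Aut M) (r : L.Rel) (xs : ∀ i, M (L.relDom r i)) :
    Str.rel r (fun i => σ • xs i) ↔ Str.rel r xs :=
  σ.2.2 r xs

variable {α : Type u} {s : α → L.Srt}

theorem Term.eval_smul (σ : L.Aut M) (v : ∀ a, M (s a)) {t : L.Srt} (x : L.Term s t) :
    x.eval (σ • v) = σ • x.eval v := by
  induction x with
  | var a => rfl
  | app f ts ih => simp only [Term.eval, ih, smul_fn]

theorem assign_smul (σ : L.Aut M) {Γ : List L.Srt} (v : ∀ a, M (s a))
    (xs : ∀ i : Fin Γ.length, M (Γ.get i)) :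
    assign (σ • v) (fun i => σ • xs i) = σ • assign v xs := by
  funext j
  cases j <;> rfl

theorem BFormula.holds_smul (σ : L.Aut M) (v : ∀ a, M (s a)) {Γ : List L.Srt}
    (φ : L.BFormula s Γ) (xs : ∀ i : Fin Γ.length, M (Γ.get i)) :
    φ.Holds (σ • v) (fun i => σ • xs i) ↔ φ.Holds v xs := by
  induction φ with
  | falsum => rfl
  | equal a b => simp only [BFormula.Holds, assign_smul, Term.eval_smul, smul_left_cancel_iff]
  | rel r ts => simp only [BFormula.Holds, assign_smul, Term.eval_smul, rel_smul]
  | imp φ ψ ih1 ih2 => simp only [BFormula.Holds, ih1, ih2]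
  | @all Γ t φ ih =>
    have key : ∀ x : M t,
        (Fin.cons (α := fun i => M ((t :: Γ).get i)) (σ • x) fun i => σ • xs i) =
          fun i => σ • (Fin.cons (α := fun i => M ((t :: Γ).get i)) x xs : ∀ i, _) i := by
      intro x
      funext i
      refine Fin.cases ?_ (fun j => ?_) i <;> rfl
    simp only [BFormula.Holds]
    constructor
    · intro h x
      have := h (σ • x)
      rw [key] at this
      exact (ih _).1 this
    · intro h x
      have := (ih _).2 (h (σ⁻¹ • x))
      have k := key (σ⁻¹ • x)
      rw [smul_inv_smul] at k
      rw [k]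
      exact this

theorem sameType_smul (σ : L.Aut M) (v : ∀ a, M (s a)) : SameType (σ • v) v := by
  intro φ
  have := BFormula.holds_smul σ v φ fun i => i.elim0
  refine Iff.trans (iff_of_eq ?_) this
  exact congrArg (BFormula.Holds (σ • v) φ) (funext fun i => i.elim0)

end Aut

/-! ### Definable and type-definable sets, monster models -/

section Definable

variable {L : MSLang.{u}} {M : L.Srt → Type u} [L.Str M] {ι : Type u} {s : ι → L.Srt}

/-- The sorts of the variables `ι` together with names for the parameters in `A`. -/
abbrev paramSort (s : ι → L.Srt) (A : Set (Σ t, M t)) : ι ⊕ A → L.Srt :=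
  Sum.elim s fun a => a.1.1

/-- The assignment sending the variables to `x` and each name to its parameter. -/
def withParams (A : Set (Σ t, M t)) (x : ∀ i, M (s i)) : ∀ j, M (paramSort s A j)
  | .inl i => x i
  | .inr a => a.1.2

/-- Sets definable by a formula with parameters from `A`. -/
def DefinableOver (A : Set (Σ t, M t)) (D : Set (∀ i, M (s i))) : Prop :=
  ∃ φ : L.Formula (paramSort s A), D = {x | φ.Realize (withParams A x)}

/-- Intersections of fewer than `κ` sets definable over `A`. -/
def TypeDefinableOver (κ : Cardinal.{u}) (A : Set (Σ t, M t)) (Z : Set (∀ i, M (s i))) : Prop :=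
  ∃ 𝒟 : Set (Set (∀ i, M (s i))), #𝒟 < κ ∧ (∀ D ∈ 𝒟, DefinableOver A D) ∧ Z = ⋂₀ 𝒟

/-- Type-definable with some small set of parameters. -/
def TypeDefinable (κ : Cardinal.{u}) (Z : Set (∀ i, M (s i))) : Prop :=
  ∃ A : Set (Σ t, M t), #A < κ ∧ TypeDefinableOver κ A Z

variable (L M)

/-- `κ`-saturation: a set of formulas in one variable, with fewer than `κ` parameters,
which is finitely satisfiable in `M` is satisfied in `M`. -/
def Saturated (κ : Cardinal.{u}) : Prop :=
  ∀ A : Set (Σ t, M t), #A < κ → ∀ (t : L.Srt)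
    (p : Set (L.Formula (paramSort (fun _ : PUnit.{u + 1} => t) A))),
    (∀ q : Set (L.Formula (paramSort (fun _ : PUnit.{u + 1} => t) A)), q ⊆ p → q.Finite →
      ∃ x : M t, ∀ φ ∈ q, φ.Realize (withParams A fun _ => x)) →
    ∃ x : M t, ∀ φ ∈ p, φ.Realize (withParams A fun _ => x)

/-- Strong `κ`-homogeneity: tuples of length less than `κ` with the same type are conjugate
under automorphisms. -/
def StronglyHomogeneous (κ : Cardinal.{u}) : Prop :=
  ∀ (ι : Type u) (s : ι → L.Srt) (a b : ∀ i, M (s i)), #ι < κ → SameType a b →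
    ∃ σ : L.Aut M, σ • a = b

/-- `M` is a monster model (of its complete theory), with `κ` as the bound for smallness. -/
structure IsMonster (κ : Cardinal.{u}) : Prop where
  strongLimit : κ.IsStrongLimit
  uncountable : ℵ₀ < κ
  small_srt : #L.Srt < κ
  small_fn : #L.Fn < κ
  small_rel : #L.Rel < κ
  saturated : Saturated L M κ
  homogeneous : StronglyHomogeneous L M κ

end Definable

/-! ### Small elementary submodels -/

section Submodel

variable {L : MSLang.{u}} {M : L.Srt → Type u} [L.Str M]

variable (L M) in
/-- Substructures. -/
structure Substr where
  carrier : ∀ t, Set (M t)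
  fn_mem : ∀ (f : L.Fn) (xs : ∀ i, M (L.fnDom f i)),
    (∀ i, xs i ∈ carrier _) → Str.fn f xs ∈ carrier (L.fnCod f)

instance (N : Substr L M) : L.Str fun t => N.carrier t where
  fn f xs := ⟨Str.fn f fun i => (xs i).1, N.fn_mem f _ fun i => (xs i).2⟩
  rel r xs := Str.rel r fun i => ((xs i).1 : M _)

/-- `N ≼ M`. -/
def Substr.IsElementary (N : Substr L M) : Prop :=
  ∀ (ι : Type u) (s : ι → L.Srt) (φ : L.Formula s) (v : ∀ i, N.carrier (s i)),
    φ.Realize (M := fun t => N.carrier t) v ↔ φ.Realize fun i => ((v i).1 : M (s i))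

/-- The tuple `m` has length less than `κ` and enumerates an elementary submodel. -/
def EnumeratesSmallModel (κ : Cardinal.{u}) {ι : Type u} {s : ι → L.Srt}
    (m : ∀ i, M (s i)) : Prop :=
  #ι < κ ∧ ∃ N : Substr L M, N.IsElementary ∧
    Set.range (fun i => (⟨s i, m i⟩ : Σ t, M t)) = {a | a.2 ∈ N.carrier a.1}

end Submodel

/-! ### Invariant equivalence relations and the logic topology -/

section Relations

variable {L : MSLang.{u}} {M : L.Srt → Type u} [L.Str M] {ι : Type u} {s : ι → L.Srt}
  {X : Set (∀ i, M (s i))}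

/-- The concatenation of two tuples. -/
def pair (x y : ∀ i, M (s i)) : ∀ j, M (Sum.elim s s j)
  | .inl i => x i
  | .inr i => y i

/-- `E` is invariant under automorphisms (in particular, so is `X`). -/
def RelInvariant (E : Setoid X) : Prop :=
  ∀ (σ : L.Aut M) (x y : X), E x y →
    ∃ (hx : σ • x.1 ∈ X) (hy : σ • y.1 ∈ X), E ⟨σ • x.1, hx⟩ ⟨σ • y.1, hy⟩

/-- `E` has fewer than `κ` classes. -/
def RelBounded (κ : Cardinal.{u}) (E : Setoid X) : Prop := #(Quotient E) < κ

/-- `E` is type-definable, as a subset of the product of two copies of the ambient product. -/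
def RelTypeDefinable (κ : Cardinal.{u}) (E : Setoid X) : Prop :=
  TypeDefinable κ {z | ∃ x y : X, E x y ∧ z = pair x.1 y.1}

/-- The `E`-class of `x`, as a subset of the ambient product. -/
def relClass (E : Setoid X) (x : X) : Set (∀ i, M (s i)) := {y | ∃ hy : y ∈ X, E x ⟨y, hy⟩}

/-- `E = E_Γ`: two points of `X` are `E`-related iff they lie in the same `Γ`-orbit. -/
def IsOrbitRel (E : Setoid X) (Γ : Subgroup (L.Aut M)) : Prop :=
  ∀ x y : X, E x y ↔ ∃ γ ∈ Γ, γ • x.1 = y.1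

/-- `Γ_E`: the group of all automorphisms preserving every `E`-class setwise. -/
def classStabilizer (E : Setoid X) : Subgroup (L.Aut M) :=
  ⨅ x : X, MulAction.stabilizer (L.Aut M) (relClass E x)

/-- The logic topology on `X/E`: closed sets are those with type-definable preimage in `X`.
(For bounded invariant `E` these sets are closed under finite unions and arbitrary
intersections, so that no closed sets are added by generating a topology.) -/
@[reducible] def logicTopology (κ : Cardinal.{u}) (E : Setoid X) : TopologicalSpace (Quotient E) :=
  TopologicalSpace.generateFrom
    {U | TypeDefinable κ {x | ∃ hx : x ∈ X, (Quotient.mk E ⟨x, hx⟩) ∈ Uᶜ}}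

end Relations

/-! ### Lascar equivalence and the Galois group -/

section Galois

variable {L : MSLang.{u}} {M : L.Srt → Type u} [L.Str M]

/-- `≡_L` on a product of sorts: the intersection of all bounded invariant
equivalence relations on that product. -/
def lascar (κ : Cardinal.{u}) {ι : Type u} (s : ι → L.Srt) : Setoid (∀ i, M (s i)) where
  r x y := ∀ E : Setoid (Set.univ : Set (∀ i, M (s i))), RelInvariant E → RelBounded κ E →
    E ⟨x, trivial⟩ ⟨y, trivial⟩
  iseqv :=
    { refl := fun _ E _ _ => E.refl _
      symm := fun h E h1 h2 => E.symm (h E h1 h2)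
      trans := fun h k E h1 h2 => E.trans (h E h1 h2) (k E h1 h2) }

theorem lascar_smul {κ : Cardinal.{u}} {ι : Type u} {s : ι → L.Srt} (σ : L.Aut M)
    {x y : ∀ i, M (s i)} (h : lascar κ s x y) : lascar κ s (σ • x) (σ • y) := by
  intro E h1 h2
  obtain ⟨_, _, h3⟩ := h1 σ _ _ (h E h1 h2)
  exact h3

variable (L M)

/-- The Lascar strong automorphisms: those preserving every `≡_L`-class of small tuples. -/
def Autf (κ : Cardinal.{u}) : Subgroup (L.Aut M) where
  carrier := {σ | ∀ (ι : Type u) (s : ι → L.Srt) (x : ∀ i, M (s i)), #ι < κ →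
    lascar κ s (σ • x) x}
  one_mem' ι s x _ := by
    rw [one_smul]
  mul_mem' {σ τ} h k ι s x hι := by
    rw [mul_smul]
    exact (lascar κ s).trans (h ι s _ hι) (k ι s x hι)
  inv_mem' {σ} h ι s x hι := by
    have := h ι s (σ⁻¹ • x) hι
    rw [smul_inv_smul] at this
    exact (lascar κ s).symm this

instance (κ : Cardinal.{u}) : (Autf L M κ).Normal where
  conj_mem σ h τ ι s x hι := by
    have := lascar_smul τ (h ι s (τ⁻¹ • x) hι)
    rw [smul_inv_smul] at this
    rwa [mul_smul, mul_smul]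

/-- The Galois group of the theory of the monster model `M`. -/
abbrev Gal (κ : Cardinal.{u}) : Type u := L.Aut M ⧸ Autf L M κ

variable {L M} {ι : Type u} {s : ι → L.Srt}

/-- The set `[m]_≡` of realizations of the type of `m`. -/
def typeSet (m : ∀ i, M (s i)) : Set (∀ i, M (s i)) := {n | SameType n m}

/-- `≡_L` restricted to `[m]_≡`. -/
def lascarOn (κ : Cardinal.{u}) (m : ∀ i, M (s i)) : Setoid (typeSet m) :=
  (lascar κ s).comap Subtype.val

/-- The map from the Galois group to `[m]_≡ / ≡_L` induced by `σ ↦ [σ(m)]`, for small `m`. -/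
def galMap (κ : Cardinal.{u}) (m : ∀ i, M (s i)) (hι : #ι < κ) :
    Gal L M κ → Quotient (lascarOn κ m) :=
  Quotient.lift (fun σ : L.Aut M => Quotient.mk (lascarOn κ m) ⟨σ • m, sameType_smul σ m⟩) (by
    intro σ τ h
    have h1 : σ⁻¹ * τ ∈ Autf L M κ := QuotientGroup.leftRel_apply.1 h
    apply Quotient.sound
    have h2 := lascar_smul σ (h1 ι s m hι)
    rw [mul_smul, smul_inv_smul] at h2
    exact (lascar κ s).symm h2)

/-- The logic topology on the Galois group, transported from `[m]_≡ / ≡_L`, where `m`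
enumerates a small elementary submodel (in which case `galMap` is a bijection). -/
@[reducible] def galTopology (κ : Cardinal.{u}) (m : ∀ i, M (s i)) (hm : EnumeratesSmallModel κ m) :
    TopologicalSpace (Gal L M κ) :=
  TopologicalSpace.induced (galMap κ m hm.1) (logicTopology κ (lascarOn κ m))

/-- `Γ` is the preimage, in the automorphism group, of a closed subgroup of the Galois group. -/
def IsPreimageOfClosed (κ : Cardinal.{u}) (m : ∀ i, M (s i)) (hm : EnumeratesSmallModel κ m)
    (Γ : Subgroup (L.Aut M)) : Prop :=
  ∃ K : Subgroup (Gal L M κ), IsClosed[galTopology κ m hm] (K : Set (Gal L M κ)) ∧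
    Γ = K.comap (QuotientGroup.mk' (Autf L M κ))

end Galois

end MSLang

open MSLang

/-! Everything is reduced to one fixed small parameter set, the entries of `m`. Call a set
type-closed over A when it is an intersection of arbitrarily many A-definable sets. For small A
there are fewer than κ formulas, so such a set is type-definable. Conversely, by compactness and
homogeneity, a type-definable set invariant under the automorphisms fixing A is type-closed over A
(`TypeClosed.image`, `TypeClosed.of_invariant`). Unlike small intersections, arbitrary ones need no
counting.

The model-theoretic input is that an automorphism fixing a small model preserves every class of a
bounded invariant equivalence relation (`RelInvariant.rel_smul_of_smul_eq`, proved with a coheir).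
Hence every union of E-classes is invariant over `m`, and closedness in X/E means type-closedness
over `m`. Similarly σ is Lascar strong iff it moves `m` inside its ≡_L-class (`mem_Autf_iff`), so Γ
is the preimage of a closed subgroup iff it contains `Autf` and the orbit Γm is type-closed over `m`
(`isPreimageOfClosed_iff`).

The cycle is 1 → 5 → 2 → 3 → 4 → 1. If E is type-definable, saturations of definable sets are
closed, and a definable set separating two classes yields disjoint open neighbourhoods. Hausdorff
spaces have closed points. If classes are type-definable, Γ_E m is the intersection over x of the
sets {σm : σx E x}, each a projection of a type-closed set. Orbitality gives E = E_{Γ_E}, since Γ ≤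
Γ_E. Finally, if E = E_Γ with Γm type-closed, then x E y iff x ∈ X and (m, x) ≡ (n, y) for some n ∈
Γm, again a projection. -/

namespace MSLang

/-! ### Syntax: substitution, quantification, finite support of formulas -/

section Substitution

variable {L : MSLang.{u}} {α β : Type u} {s : α → L.Srt} {s' : β → L.Srt}

/-- Substitution of terms for the variables of a term. -/
def Term.subst (g : ∀ a, L.Term s' (s a)) : {t : L.Srt} → L.Term s t → L.Term s' t
  | _, .var a => g a
  | _, .app f ts => .app f fun i => (ts i).subst g

theorem Term.eval_subst {M : L.Srt → Type u} [L.Str M] (g : ∀ a, L.Term s' (s a))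
    (v : ∀ b, M (s' b)) {t : L.Srt} (x : L.Term s t) :
    (x.subst g).eval v = x.eval fun a => (g a).eval v := by
  induction x with
  | var a => rfl
  | app f ts ih => simp only [Term.subst, Term.eval, ih]

/-- The variables of a context, in the scope of one more bound variable. -/
def shiftVar (s' : β → L.Srt) (Δ : List L.Srt) (t : L.Srt) :
    ∀ j, L.Term (ctx s' (t :: Δ)) (ctx s' Δ j)
  | .inl b => .var (s := ctx s' (t :: Δ)) (.inl b)
  | .inr i => .var (s := ctx s' (t :: Δ)) (.inr i.succ)

/-- A substitution, in the scope of one more bound variable. -/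
def liftSubst {Γ Δ : List L.Srt} (g : ∀ j, L.Term (ctx s' Δ) (ctx s Γ j)) (t : L.Srt) :
    ∀ j, L.Term (ctx s' (t :: Δ)) (ctx s (t :: Γ) j)
  | .inl a => (g (.inl a)).subst (shiftVar s' Δ t)
  | .inr i => Fin.cases (motive := fun i => L.Term (ctx s' (t :: Δ)) (ctx s (t :: Γ) (.inr i)))
      (.var (s := ctx s' (t :: Δ)) (.inr 0))
      (fun k => (g (.inr k)).subst (shiftVar s' Δ t)) i

/-- Substitution of terms for the free and bound variables of a formula. -/
def BFormula.subst : {Γ Δ : List L.Srt} → (∀ j, L.Term (ctx s' Δ) (ctx s Γ j)) →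
    L.BFormula s Γ → L.BFormula s' Δ
  | _, _, _, .falsum => .falsum
  | _, _, g, .equal a b => .equal (a.subst g) (b.subst g)
  | _, _, g, .rel r ts => .rel r fun i => (ts i).subst g
  | _, _, g, .imp φ ψ => .imp (φ.subst g) (ψ.subst g)
  | _, _, g, .all t φ => .all t (φ.subst (liftSubst g t))

variable {M : L.Srt → Type u} [L.Str M]

theorem eval_shiftVar (v : ∀ b, M (s' b)) {Δ : List L.Srt} {t : L.Srt}
    (ys : ∀ i : Fin Δ.length, M (Δ.get i)) (x : M t) (j) :
    (shiftVar s' Δ t j).eval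
      (assign v (Fin.cons (α := fun i => M ((t :: Δ).get i)) x ys)) = assign v ys j := by
  cases j <;> rfl

/-- Induction with the target context generalized: under a quantifier both contexts grow by the same
variable, and `liftSubst` preserves the hypothesis on values. -/
theorem BFormula.holds_subst {Γ Δ : List L.Srt} (g : ∀ j, L.Term (ctx s' Δ) (ctx s Γ j))
    (φ : L.BFormula s Γ) (v : ∀ a, M (s a)) (xs : ∀ i : Fin Γ.length, M (Γ.get i))
    (w : ∀ b, M (s' b)) (ys : ∀ i : Fin Δ.length, M (Δ.get i))
    (h : ∀ j, (g j).eval (assign w ys) = assign v xs j) :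
    (φ.subst g).Holds w ys ↔ φ.Holds v xs := by
  induction φ generalizing Δ with
  | falsum => rfl
  | equal a b => simp only [BFormula.subst, BFormula.Holds, Term.eval_subst, h]
  | rel r ts => simp only [BFormula.subst, BFormula.Holds, Term.eval_subst, h]
  | imp φ ψ ih1 ih2 => simp only [BFormula.subst, BFormula.Holds, ih1 g xs ys h, ih2 g xs ys h]
  | all t φ ih =>
    simp only [BFormula.subst, BFormula.Holds]
    refine forall_congr' fun x => ih _ _ _ fun j => ?_
    have key : ∀ {t'} (y : L.Term (ctx s' Δ) t'), (y.subst (shiftVar s' Δ t)).eval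
        (assign w (Fin.cons (α := fun i => M ((t :: Δ).get i)) x ys)) = y.eval (assign w ys) := by
      intro t' y
      rw [Term.eval_subst]
      congr 1
      funext j
      exact eval_shiftVar w ys x j
    rcases j with a | i
    · exact (key _).trans (h (.inl a))
    · refine Fin.cases ?_ (fun k => ?_) i
      · rfl
      · exact (key _).trans (h (.inr k))

/-- A substitution of terms, in the absence of bound variables. -/
def freeSubst (g : ∀ a, L.Term s' (s a)) : ∀ j, L.Term (ctx s' []) (ctx s [] j)
  | .inl a => (g a).subst fun b => .var (s := ctx s' []) (.inl b)
  | .inr i => i.elim0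

/-- Substitution of terms for the free variables of a formula. -/
def Formula.substFree (g : ∀ a, L.Term s' (s a)) (φ : L.Formula s) : L.Formula s' :=
  BFormula.subst (freeSubst g) φ

theorem Formula.realize_substFree (g : ∀ a, L.Term s' (s a)) (φ : L.Formula s)
    (w : ∀ b, M (s' b)) :
    (φ.substFree g).Realize w ↔ φ.Realize fun a => (g a).eval w := by
  refine BFormula.holds_subst _ φ _ _ _ _ fun j => ?_
  rcases j with a | i
  · exact Term.eval_subst _ _ _
  · exact i.elim0

/-- The substitution binding a distinguished free variable. -/
def bindSubst (s : α → L.Srt) (t : L.Srt) :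
    ∀ j, L.Term (ctx s [t]) (ctx (Sum.elim (fun _ : PUnit.{u + 1} => t) s) [] j)
  | .inl (.inl _) => .var (s := ctx s [t]) (.inr 0)
  | .inl (.inr a) => .var (s := ctx s [t]) (.inl a)
  | .inr i => i.elim0

/-- Existential quantification over a distinguished free variable. -/
def Formula.exists_ {t : L.Srt}
    (φ : L.Formula (Sum.elim (fun _ : PUnit.{u + 1} => t) s)) : L.Formula s :=
  .imp (.all t (.imp (BFormula.subst (bindSubst s t) φ) .falsum)) .falsum

/-- The assignment extending `v` by the value `x` of a distinguished variable. -/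
def consAssign {t : L.Srt} (x : M t) (v : ∀ a, M (s a)) :
    ∀ j, M (Sum.elim (fun _ : PUnit.{u + 1} => t) s j)
  | .inl _ => x
  | .inr a => v a

theorem Formula.realize_exists_ {t : L.Srt}
    (φ : L.Formula (Sum.elim (fun _ : PUnit.{u + 1} => t) s)) (v : ∀ a, M (s a)) :
    φ.exists_.Realize v ↔ ∃ x : M t, φ.Realize (consAssign x v) := by
  have key : ∀ x : M t, (BFormula.subst (bindSubst s t) φ).Holds v
      (Fin.cons (α := fun i => M ([t].get i)) x fun i => i.elim0)
      ↔ φ.Realize (consAssign x v) := by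
    intro x
    refine BFormula.holds_subst _ φ _ _ _ _ fun j => ?_
    rcases j with (_ | a) | i
    · rfl
    · rfl
    · exact i.elim0
  simp only [Formula.exists_, Formula.Realize, BFormula.Holds]
  rw [← not_forall_not]
  refine not_congr (forall_congr' fun x => ?_)
  exact not_congr (key x)

theorem Term.exists_finset_eval_eq {t : L.Srt} (x : L.Term s t) :
    ∃ F : Finset α, ∀ v w : ∀ a, M (s a), (∀ a ∈ F, v a = w a) → x.eval v = x.eval w := by
  classical
  induction x with
  | var a => exact ⟨{a}, fun v w h => h a (by simp)⟩
  | app f ts ih =>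
    choose F hF using ih
    refine ⟨Finset.univ.biUnion F, fun v w h => ?_⟩
    simp only [Term.eval]
    congr 1
    funext i
    exact hF i v w fun a ha => h a (Finset.mem_biUnion.2 ⟨i, Finset.mem_univ _, ha⟩)

theorem Term.exists_finset_eval_assign_eq {Γ : List L.Srt} {t : L.Srt}
    (x : L.Term (ctx s Γ) t) :
    ∃ F : Finset α, ∀ (v w : ∀ a, M (s a)) (xs : ∀ i : Fin Γ.length, M (Γ.get i)),
      (∀ a ∈ F, v a = w a) → x.eval (assign v xs) = x.eval (assign w xs) := by
  obtain ⟨F, hF⟩ := x.exists_finset_eval_eq (M := M)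
  refine ⟨F.toLeft, fun v w xs h => hF _ _ fun j hj => ?_⟩
  rcases j with a | i
  · exact h a (Finset.mem_toLeft.2 hj)
  · rfl

theorem BFormula.exists_finset_holds_iff {Γ : List L.Srt} (φ : L.BFormula s Γ) :
    ∃ F : Finset α, ∀ (v w : ∀ a, M (s a)) (xs : ∀ i : Fin Γ.length, M (Γ.get i)),
      (∀ a ∈ F, v a = w a) → (φ.Holds v xs ↔ φ.Holds w xs) := by
  classical
  induction φ with
  | falsum => exact ⟨∅, fun _ _ _ _ => Iff.rfl⟩
  | equal a b =>
    obtain ⟨F, hF⟩ := a.exists_finset_eval_assign_eq (M := M)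
    obtain ⟨G, hG⟩ := b.exists_finset_eval_assign_eq (M := M)
    refine ⟨F ∪ G, fun v w xs h => ?_⟩
    simp only [BFormula.Holds]
    rw [hF v w xs fun a ha => h a (Finset.mem_union_left _ ha),
      hG v w xs fun a ha => h a (Finset.mem_union_right _ ha)]
  | rel r ts =>
    choose F hF using fun i => (ts i).exists_finset_eval_assign_eq (M := M)
    refine ⟨Finset.univ.biUnion F, fun v w xs h => ?_⟩
    simp only [BFormula.Holds]
    refine iff_of_eq (congrArg _ (funext fun i => ?_))
    exact hF i v w xs fun a ha => h a (Finset.mem_biUnion.2 ⟨i, Finset.mem_univ _, ha⟩)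
  | imp φ ψ ih1 ih2 =>
    obtain ⟨F, hF⟩ := ih1
    obtain ⟨G, hG⟩ := ih2
    refine ⟨F ∪ G, fun v w xs h => ?_⟩
    exact imp_congr (hF v w xs fun a ha => h a (Finset.mem_union_left _ ha))
      (hG v w xs fun a ha => h a (Finset.mem_union_right _ ha))
  | all t φ ih =>
    obtain ⟨F, hF⟩ := ih
    exact ⟨F, fun v w xs h => forall_congr' fun x => hF v w _ h⟩

end Substitution

/-! ### Counting formulas -/

section Cardinality

variable {L : MSLang.{u}} {α : Type u} {s : α → L.Srt}

/-- Labels of the nodes of the syntax trees of terms. -/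
abbrev TermNode (L : MSLang.{u}) (α : Type u) : Type u := α ⊕ ULift.{u} ℕ ⊕ L.Fn

/-- The number of children of a node of the syntax tree of a term. -/
def TermNode.arity : TermNode L α → ℕ
  | .inl _ => 0
  | .inr (.inl _) => 0
  | .inr (.inr f) => L.fnLen f

/-- Unsorted syntax trees of terms. -/
abbrev TermTree (L : MSLang.{u}) (α : Type u) : Type u :=
  WType fun a : TermNode L α => ULift.{u} (Fin a.arity)

/-- Syntax trees of terms. -/
def Term.toTree {Γ : List L.Srt} : {t : L.Srt} → L.Term (ctx s Γ) t → TermTree L α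
  | _, .var (.inl a) => ⟨.inl a, fun i => i.down.elim0⟩
  | _, .var (.inr i) => ⟨.inr (.inl ⟨i⟩), fun i => i.down.elim0⟩
  | _, .app f ts => ⟨.inr (.inr f), fun i => (ts i.down).toTree⟩

/-- The root of a tree determines the sort of the term, so forgetting sorts loses nothing. The two
sorts are kept distinct in the statement so that the induction can conclude that they agree. -/
theorem Term.toTree_inj {Γ : List L.Srt} {t t' : L.Srt} (x : L.Term (ctx s Γ) t)
    (y : L.Term (ctx s Γ) t') (h : x.toTree = y.toTree) : t = t' ∧ HEq x y := by
  induction x generalizing t' with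
  | var j =>
    cases y with
    | var k =>
      have : j = k := by
        rcases j with a | i <;> rcases k with b | i' <;> simp [Term.toTree] at h
        · rw [h.1]
        · rw [Fin.ext h.1]
      subst this
      exact ⟨rfl, HEq.rfl⟩
    | app g us => rcases j with a | i <;> simp [Term.toTree] at h
  | app f ts ih =>
    cases y with
    | var k => rcases k with b | i' <;> simp [Term.toTree] at h
    | app g us =>
      simp only [Term.toTree, WType.mk.injEq, Sum.inr.injEq] at h
      obtain ⟨rfl, h⟩ := h
      refine ⟨rfl, heq_of_eq ?_⟩
      congr 1
      funext i
      exact eq_of_heq (ih i (us i) (congrFun (eq_of_heq h) ⟨i⟩)).2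

/-- Labels of the nodes of the syntax trees of formulas. -/
abbrev FormulaNode (L : MSLang.{u}) (α : Type u) : Type u :=
  List L.Srt × (PUnit.{u + 1} ⊕ (TermTree L α × TermTree L α) ⊕ (L.Rel × List (TermTree L α)) ⊕
    PUnit.{u + 1} ⊕ L.Srt)

/-- The number of children of a node of the syntax tree of a formula. -/
def FormulaNode.arity : FormulaNode L α → ℕ
  | (_, .inl _) => 0
  | (_, .inr (.inl _)) => 0
  | (_, .inr (.inr (.inl _))) => 0
  | (_, .inr (.inr (.inr (.inl _)))) => 2
  | (_, .inr (.inr (.inr (.inr _)))) => 1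

/-- Unsorted syntax trees of formulas. -/
abbrev FormulaTree (L : MSLang.{u}) (α : Type u) : Type u :=
  WType fun a : FormulaNode L α => ULift.{u} (Fin a.arity)

/-- Syntax trees of formulas. -/
def BFormula.toTree : {Γ : List L.Srt} → L.BFormula s Γ → FormulaTree L α
  | Γ, .falsum => ⟨(Γ, .inl ⟨⟩), fun i => i.down.elim0⟩
  | Γ, .equal a b => ⟨(Γ, .inr (.inl (a.toTree, b.toTree))), fun i => i.down.elim0⟩
  | Γ, .rel r ts => ⟨(Γ, .inr (.inr (.inl (r, List.ofFn fun i => (ts i).toTree)))),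
      fun i => i.down.elim0⟩
  | Γ, .imp φ ψ => ⟨(Γ, .inr (.inr (.inr (.inl ⟨⟩)))), fun i => ![φ.toTree, ψ.toTree] i.down⟩
  | Γ, .all t φ => ⟨(Γ, .inr (.inr (.inr (.inr t)))), fun _ => φ.toTree⟩

theorem BFormula.toTree_inj {Γ Δ : List L.Srt} (φ : L.BFormula s Γ) (ψ : L.BFormula s Δ)
    (h : φ.toTree = ψ.toTree) : Γ = Δ ∧ HEq φ ψ := by
  induction φ generalizing Δ with
  | falsum =>
    cases ψ <;> simp [BFormula.toTree] at h
    obtain ⟨rfl, -⟩ := h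
    exact ⟨rfl, HEq.rfl⟩
  | equal a b =>
    cases ψ <;> simp only [BFormula.toTree, WType.mk.injEq, Prod.mk.injEq, Sum.inr.injEq,
      Sum.inl.injEq, reduceCtorEq, and_false, false_and] at h
    obtain ⟨⟨rfl, h1, h2⟩, -⟩ := h
    obtain ⟨rfl, h1⟩ := Term.toTree_inj _ _ h1
    obtain ⟨-, h2⟩ := Term.toTree_inj _ _ h2
    cases h1
    cases h2
    exact ⟨rfl, HEq.rfl⟩
  | rel r ts =>
    cases ψ <;> simp only [BFormula.toTree, WType.mk.injEq, Prod.mk.injEq, Sum.inr.injEq,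
      Sum.inl.injEq, reduceCtorEq, and_false, false_and] at h
    obtain ⟨⟨rfl, rfl, h1⟩, -⟩ := h
    refine ⟨rfl, heq_of_eq ?_⟩
    congr 1
    funext i
    exact eq_of_heq (Term.toTree_inj _ _ (congrFun (List.ofFn_injective h1) i)).2
  | imp φ1 φ2 ih1 ih2 =>
    cases ψ <;> simp only [BFormula.toTree, WType.mk.injEq, Prod.mk.injEq, Sum.inr.injEq,
      reduceCtorEq, and_false, false_and] at h
    obtain ⟨⟨rfl, -⟩, h1⟩ := h
    have h1 := eq_of_heq h1
    obtain ⟨-, h2⟩ := ih1 _ (congrFun h1 ⟨(0 : Fin 2)⟩)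
    obtain ⟨-, h3⟩ := ih2 _ (congrFun h1 ⟨(1 : Fin 2)⟩)
    cases h2
    cases h3
    exact ⟨rfl, HEq.rfl⟩
  | all t φ ih =>
    cases ψ <;> simp only [BFormula.toTree, WType.mk.injEq, Prod.mk.injEq, Sum.inr.injEq,
      reduceCtorEq, and_false, false_and] at h
    obtain ⟨⟨rfl, rfl⟩, h1⟩ := h
    obtain ⟨-, h2⟩ := ih _ (congrFun (eq_of_heq h1) ⟨(0 : Fin 1)⟩)
    cases h2
    exact ⟨rfl, HEq.rfl⟩

/-- Formulas embed into finitely branching trees whose set of labels has size less than κ, and κ is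
uncountable. -/
theorem mk_formula_lt {κ : Cardinal.{u}} (hκ : ℵ₀ < κ) (h1 : #L.Srt < κ) (h2 : #L.Fn < κ)
    (h3 : #L.Rel < κ) (hα : #α < κ) : #(L.Formula s) < κ := by
  have hκ' := hκ.le
  have h0 : #(ULift.{u} ℕ) < κ := by simpa using hκ
  have hu : #PUnit.{u + 1} < κ := by simpa using one_lt_aleph0.trans hκ
  have hlist : ∀ {β : Type u}, #β < κ → #(List β) < κ := fun h =>
    (mk_list_le_max _).trans_lt (max_lt hκ h)
  have hterm : #(TermTree L α) < κ := by
    refine (WType.cardinalMk_le_max_aleph0_of_finite).trans_lt (max_lt ?_ hκ)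
    simp only [TermNode, mk_sum, lift_id]
    exact add_lt_of_lt hκ' hα (add_lt_of_lt hκ' h0 h2)
  have htree : #(FormulaTree L α) < κ := by
    refine (WType.cardinalMk_le_max_aleph0_of_finite).trans_lt (max_lt ?_ hκ)
    simp only [FormulaNode, mk_sum, mk_prod, lift_id]
    exact mul_lt_of_lt hκ' (hlist h1) (add_lt_of_lt hκ' hu (add_lt_of_lt hκ'
      (mul_lt_of_lt hκ' hterm hterm) (add_lt_of_lt hκ' (mul_lt_of_lt hκ' h3 (hlist hterm))
        (add_lt_of_lt hκ' hu h1))))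
  refine (mk_le_of_injective (f := BFormula.toTree) fun φ ψ h => ?_).trans_lt htree
  exact eq_of_heq (BFormula.toTree_inj φ ψ h).2

end Cardinality
-- Finite supports, ultrafilters, entries of tuples
section Tuples

variable {L : MSLang.{u}} {M : L.Srt → Type u} {ι : Type u} {s : ι → L.Srt}
  {A B : Set (Σ t, M t)} {D D' : Set (∀ i, M (s i))}

/-- Membership in `D` depends only on the coordinates in `F`. -/
def SupportedOn (D : Set (∀ i, M (s i))) (F : Finset ι) : Prop :=
  ∀ z w : ∀ i, M (s i), (∀ i ∈ F, z i = w i) → (z ∈ D ↔ w ∈ D)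

theorem SupportedOn.inter [DecidableEq ι] {F F' : Finset ι} (h : SupportedOn D F)
    (h' : SupportedOn D' F') : SupportedOn (D ∩ D') (F ∪ F') := fun z w hzw =>
  and_congr (h z w fun i hi => hzw i (Finset.mem_union_left _ hi))
    (h' z w fun i hi => hzw i (Finset.mem_union_right _ hi))

theorem SupportedOn.exists_update [DecidableEq ι] {F : Finset ι} (h : SupportedOn D F) (i : ι) :
    SupportedOn {z | ∃ x, Function.update z i x ∈ D} (F.erase i) := fun z w hzw =>
  exists_congr fun x => h _ _ fun j hj => by
    by_cases hji : j = i
    · subst hji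
      simp
    · simp [hji, hzw j (Finset.mem_erase.2 ⟨hji, hj⟩)]

theorem SupportedOn.mem_of_empty (h : SupportedOn D ∅) {z : ∀ i, M (s i)} (hz : z ∈ D)
    (w : ∀ i, M (s i)) : w ∈ D :=
  (h z w (by simp)).1 hz

theorem exists_ultrafilter {γ : Type*} (𝓕 : Set (Set γ)) (huniv : Set.univ ∈ 𝓕)
    (hinter : ∀ D ∈ 𝓕, ∀ D' ∈ 𝓕, D ∩ D' ∈ 𝓕) (Q : Set γ) (h : ∀ D ∈ 𝓕, (D ∩ Q).Nonempty) :
    ∃ U : Ultrafilter γ, Q ∈ U ∧ ∀ D ∈ 𝓕, D ∈ U := by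
  let F : Filter γ :=
    { sets := {S | ∃ D ∈ 𝓕, D ∩ Q ⊆ S}
      univ_sets := ⟨_, huniv, Set.subset_univ _⟩
      sets_of_superset := fun ⟨D, hD, hS⟩ hST => ⟨D, hD, hS.trans hST⟩
      inter_sets := fun ⟨D, hD, hS⟩ ⟨D', hD', hS'⟩ => ⟨_, hinter D hD D' hD', fun x hx =>
        ⟨hS ⟨hx.1.1, hx.2⟩, hS' ⟨hx.1.2, hx.2⟩⟩⟩ }
  have : F.NeBot := by
    refine ⟨fun hbot => ?_⟩
    obtain ⟨D, hD, hS⟩ : (∅ : Set γ) ∈ F := hbot ▸ Filter.mem_bot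
    obtain ⟨x, hx⟩ := h D hD
    exact hS hx
  refine ⟨Ultrafilter.of F, Ultrafilter.of_le F ?_, fun D hD => Ultrafilter.of_le F ?_⟩
  · exact ⟨_, huniv, Set.inter_subset_right⟩
  · exact ⟨D, hD, Set.inter_subset_left⟩

/-- The entries of a tuple. -/
def entries (x : ∀ i, M (s i)) : Set (Σ t, M t) := Set.range fun i => ⟨s i, x i⟩

theorem mk_entries_lt {κ : Cardinal.{u}} (hι : #ι < κ) (x : ∀ i, M (s i)) : #(entries x) < κ :=
  mk_range_le.trans_lt hι

theorem mk_union_lt {κ : Cardinal.{u}} (hκ : ℵ₀ < κ) (hA : #A < κ) (hB : #B < κ) :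
    #(A ∪ B : Set (Σ t, M t)) < κ :=
  (mk_union_le A B).trans_lt (add_lt_of_lt hκ.le hA hB)

end Tuples

/-! ### Definable sets and compactness for small tuples -/

section DefinableSets

variable {L : MSLang.{u}} {M : L.Srt → Type u} [L.Str M] {ι ι' : Type u} {s : ι → L.Srt}
  {s' : ι' → L.Srt} {A B : Set (Σ t, M t)} {D D' : Set (∀ i, M (s i))}

theorem DefinableOver.compl (h : DefinableOver A D) : DefinableOver A Dᶜ := by
  obtain ⟨φ, rfl⟩ := h
  exact ⟨.imp φ .falsum, rfl⟩

theorem definableOver_empty : DefinableOver A (∅ : Set (∀ i, M (s i))) :=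
  ⟨.falsum, rfl⟩

theorem definableOver_univ : DefinableOver A (Set.univ : Set (∀ i, M (s i))) := by
  simpa using definableOver_empty.compl (A := A) (s := s)

theorem DefinableOver.union (h : DefinableOver A D) (h' : DefinableOver A D') :
    DefinableOver A (D ∪ D') := by
  obtain ⟨φ, rfl⟩ := h
  obtain ⟨ψ, rfl⟩ := h'
  refine ⟨.imp (.imp φ .falsum) ψ, Set.ext fun x => ?_⟩
  exact or_iff_not_imp_left

theorem DefinableOver.inter (h : DefinableOver A D) (h' : DefinableOver A D') :
    DefinableOver A (D ∩ D') := by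
  simpa using (h.compl.union h'.compl).compl

/-- Each coordinate of `f` is the value of a term with parameters in `B`. -/
def IsTermMap (B : Set (Σ t, M t)) (f : (∀ i, M (s' i)) → ∀ i, M (s i)) : Prop :=
  ∀ i, ∃ t : L.Term (paramSort s' B) (s i), ∀ z, f z i = t.eval (withParams B z)

/-- Substituting terms into a formula covers at once change of parameters, projections of variables
and specialization to constants. -/
theorem DefinableOver.preimage (hAB : A ⊆ B) (hD : DefinableOver A D)
    {f : (∀ i, M (s' i)) → ∀ i, M (s i)} (hf : IsTermMap B f) : DefinableOver B (f ⁻¹' D) := by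
  obtain ⟨φ, rfl⟩ := hD
  have : ∀ j, ∃ t : L.Term (paramSort s' B) (paramSort s A j),
      ∀ z, withParams A (f z) j = t.eval (withParams B z) := by
    rintro (i | a)
    · exact hf i
    · exact ⟨.var (s := paramSort s' B) (.inr ⟨a.1, hAB a.2⟩), fun z => rfl⟩
  choose g hg using this
  refine ⟨φ.substFree g, Set.ext fun z => ?_⟩
  simp only [Set.mem_preimage, Set.mem_ofPred_eq, Formula.realize_substFree, ← hg]

theorem isTermMap_id : IsTermMap A fun z : ∀ i, M (s i) => z :=
  fun i => ⟨.var (s := paramSort s A) (.inl i), fun _ => rfl⟩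

theorem DefinableOver.mono (hAB : A ⊆ B) (hD : DefinableOver A D) : DefinableOver B D :=
  hD.preimage hAB isTermMap_id

theorem DefinableOver.exists_update [DecidableEq ι] (hD : DefinableOver A D) (i : ι) :
    DefinableOver A {z | ∃ x, Function.update z i x ∈ D} := by
  obtain ⟨φ, rfl⟩ := hD
  have : ∀ j, ∃ t : L.Term (Sum.elim (fun _ : PUnit.{u + 1} => s i) (paramSort s A))
      (paramSort s A j), ∀ x (z : ∀ i, M (s i)),
        t.eval (consAssign x (withParams A z)) = withParams A (Function.update z i x) j := by
    rintro (k | a)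
    · by_cases h : k = i
      · subst h
        refine ⟨.var (s := Sum.elim (fun _ : PUnit.{u + 1} => s k) (paramSort s A)) (.inl ⟨⟩),
          fun x z => ?_⟩
        simp [withParams, Term.eval, consAssign]
      · refine ⟨.var (s := Sum.elim (fun _ : PUnit.{u + 1} => s i) (paramSort s A))
          (.inr (.inl k)), fun x z => ?_⟩
        simp [withParams, Term.eval, consAssign, h]
    · exact ⟨.var (s := Sum.elim (fun _ : PUnit.{u + 1} => s i) (paramSort s A))
        (.inr (.inr a)), fun x z => rfl⟩
  choose g hg using this
  refine ⟨(φ.substFree g).exists_, Set.ext fun z => ?_⟩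
  simp only [Set.mem_ofPred_eq, Formula.realize_exists_, Formula.realize_substFree, hg]

theorem DefinableOver.exists_supportedOn (hD : DefinableOver A D) :
    ∃ F : Finset ι, SupportedOn D F := by
  classical
  obtain ⟨φ, rfl⟩ := hD
  obtain ⟨F, hF⟩ := BFormula.exists_finset_holds_iff (M := M) φ
  refine ⟨F.toLeft, fun z w h => hF _ _ _ fun j hj => ?_⟩
  rcases j with i | a
  · exact h i (Finset.mem_toLeft.2 hj)
  · rfl

theorem sameType_iff {a b : ∀ i, M (s i)} :
    SameType a b ↔ ∀ D, DefinableOver ∅ D → (a ∈ D ↔ b ∈ D) := by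
  constructor
  · rintro h D ⟨φ, rfl⟩
    have : ∀ j : ι ⊕ (∅ : Set (Σ t, M t)), ∃ t : L.Term s (paramSort s ∅ j),
        ∀ z, t.eval z = withParams ∅ z j := by
      rintro (i | a)
      · exact ⟨.var i, fun _ => rfl⟩
      · exact a.2.elim
    choose g hg using this
    have := h (φ.substFree g)
    simp only [Formula.realize_substFree, hg] at this
    exact this
  · intro h φ
    have := h _ ⟨φ.substFree fun i => .var (s := paramSort s ∅) (.inl i), rfl⟩
    exact (Formula.realize_substFree _ φ _).symm.trans
      (this.trans (Formula.realize_substFree _ φ _))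

theorem isTermMap_const {x : ∀ i, M (s i)} (hx : entries x ⊆ B) :
    IsTermMap B fun _ : ∀ i, M (s' i) => x :=
  fun i => ⟨.var (s := paramSort s' B) (.inr ⟨⟨s i, x i⟩, hx ⟨i, rfl⟩⟩), fun _ => rfl⟩

theorem isTermMap_update [DecidableEq ι] {x : ∀ i, M (s i)} (hx : entries x ⊆ B) (i : ι) :
    IsTermMap B fun y : PUnit.{u + 1} → M (s i) => Function.update x i (y ⟨⟩) := by
  intro j
  by_cases h : j = i
  · subst h
    exact ⟨.var (s := paramSort (fun _ : PUnit.{u + 1} => s j) B) (.inl ⟨⟩), fun z => by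
      simp [Term.eval, withParams]⟩
  · exact ⟨.var (s := paramSort (fun _ : PUnit.{u + 1} => s i) B)
      (.inr ⟨⟨s j, x j⟩, hx ⟨j, rfl⟩⟩), fun z => by simp [Term.eval, withParams, h]⟩

/-- Compactness: an ultrafilter on a small product of sorts has a realization over each small
set of parameters. -/
theorem exists_realization {κ : Cardinal.{u}} (hκ : ℵ₀ < κ) (hM : Saturated L M κ) (hA : #A < κ)
    (hι : #ι < κ) (U : Ultrafilter (∀ i, M (s i))) :
    ∃ x, ∀ D, DefinableOver A D → D ∈ U → x ∈ D := by
  classical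
  obtain ⟨base, -⟩ := U.nonempty_of_mem Filter.univ_mem
  -- Zorn's lemma on partial realizations: `p.2` is a candidate tuple trusted only on the
  -- coordinates in `p.1`, and must lie in every U-large A-definable set with finite support inside
  -- `p.1`.
  let P : Set ι × (∀ i, M (s i)) → Prop := fun p => ∀ D, DefinableOver A D → ∀ F : Finset ι,
    (F : Set ι) ⊆ p.1 → SupportedOn D F → D ∈ U → p.2 ∈ D
  let r : {p // P p} → {p // P p} → Prop := fun p q =>
    p.1.1 ⊆ q.1.1 ∧ ∀ i ∈ p.1.1, p.1.2 i = q.1.2 i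
  have htrans : ∀ {a b c}, r a b → r b c → r a c := fun hab hbc =>
    ⟨hab.1.trans hbc.1, fun i hi => (hab.2 i hi).trans (hbc.2 i (hab.1 hi))⟩
  have hrefl : ∀ a, r a a := fun a => ⟨subset_rfl, fun _ _ => rfl⟩
  obtain ⟨⟨⟨S, x⟩, hx⟩, hmax⟩ := exists_maximal_of_chains_bounded (r := r) (by
    intro c hc
    rcases c.eq_empty_or_nonempty with rfl | hne
    · refine ⟨⟨(∅, base), fun D _ F hF hDF hDU => ?_⟩, by simp⟩
      obtain ⟨w, hw⟩ := U.nonempty_of_mem hDU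
      obtain rfl : F = ∅ := by simpa using hF
      exact hDF.mem_of_empty hw base
    · have hdir : ∀ p ∈ c, ∀ q ∈ c, ∃ o ∈ c, r p o ∧ r q o := by
        intro p hp q hq
        by_cases hpq : p = q
        · exact ⟨q, hq, hpq ▸ hrefl _, hrefl _⟩
        · rcases hc hp hq hpq with h | h
          · exact ⟨q, hq, h, hrefl _⟩
          · exact ⟨p, hp, hrefl _, h⟩
      -- The upper bound glues the tuples of the chain; outside the union of their domains the value
      -- is irrelevant. A finite support inside the union lies in one domain, so the glued tuple is
      -- again a partial realization.
      let y : ∀ i, M (s i) := fun i =>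
        if h : ∃ p ∈ c, i ∈ p.1.1 then h.choose.1.2 i else base i
      have hy : ∀ p ∈ c, ∀ i ∈ p.1.1, p.1.2 i = y i := by
        intro p hp i hi
        have h : ∃ p ∈ c, i ∈ p.1.1 := ⟨p, hp, hi⟩
        obtain ⟨o, -, h1, h2⟩ := hdir p hp _ h.choose_spec.1
        simp only [y, dif_pos h]
        rw [h1.2 i hi, h2.2 i h.choose_spec.2]
      have hfin : ∀ F : Finset ι, (F : Set ι) ⊆ ⋃ p ∈ c, p.1.1 →
          ∃ p ∈ c, (F : Set ι) ⊆ p.1.1 := by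
        intro F
        induction F using Finset.induction_on with
        | empty => exact fun _ => ⟨_, hne.choose_spec, by simp⟩
        | insert a F ha ih =>
          intro h
          rw [Finset.coe_insert, Set.insert_subset_iff] at h
          obtain ⟨p, hp, hpF⟩ := ih h.2
          obtain ⟨q, hq, haq⟩ := Set.mem_iUnion₂.1 h.1
          obtain ⟨o, ho, h1, h2⟩ := hdir p hp q hq
          refine ⟨o, ho, ?_⟩
          rw [Finset.coe_insert, Set.insert_subset_iff]
          exact ⟨h2.1 haq, hpF.trans h1.1⟩
      refine ⟨⟨(⋃ p ∈ c, p.1.1, y), fun D hD F hF hDF hDU => ?_⟩, fun p hp =>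
        ⟨Set.subset_biUnion_of_mem (u := fun p : {p // P p} => p.1.1) hp, hy p hp⟩⟩
      obtain ⟨p, hp, hpF⟩ := hfin F hF
      exact (hDF _ _ fun i hi => hy p hp i (hpF hi)).1 (p.2 D hD F hpF hDF hDU)) htrans
  suffices hS : S = Set.univ by
    refine ⟨x, fun D hD hDU => ?_⟩
    obtain ⟨F, hF⟩ := hD.exists_supportedOn
    exact hx D hD F (by simp [hS]) hF hDU
  by_contra hS
  obtain ⟨i, hi⟩ := (Set.ne_univ_iff_exists_notMem S).1 hS
  let A' := A ∪ entries x
  -- The conditions on the missing coordinate i, with the known coordinates of x plugged in as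
  -- parameters; a realization extends x and contradicts maximality.
  let p : Set (L.Formula (paramSort (fun _ : PUnit.{u + 1} => s i) A')) := {ψ | ∃ D, ∃ F : Finset ι,
    DefinableOver A D ∧ (F : Set ι) ⊆ insert i S ∧ SupportedOn D F ∧ D ∈ U ∧
    ∀ t, ψ.Realize (withParams A' fun _ => t) ↔ Function.update x i t ∈ D}
  obtain ⟨t, ht⟩ := hM A' (mk_union_lt hκ hA (mk_entries_lt hι x)) (s i) p (by
    intro q hqp hq
    have : ∃ D, ∃ F : Finset ι, DefinableOver A D ∧ (F : Set ι) ⊆ insert i S ∧ SupportedOn D F ∧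
        D ∈ U ∧ ∀ t, Function.update x i t ∈ D → ∀ ψ ∈ q, ψ.Realize (withParams A' fun _ => t) := by
      refine Set.Finite.induction_on_subset q hq
        (motive := fun q _ => ∃ D, ∃ F : Finset ι, DefinableOver A D ∧ (F : Set ι) ⊆ insert i S ∧
          SupportedOn D F ∧ D ∈ U ∧ ∀ t, Function.update x i t ∈ D → ∀ ψ ∈ q,
            ψ.Realize (withParams A' fun _ => t))
        ⟨Set.univ, ∅, definableOver_univ, by simp, fun _ _ _ => Iff.rfl, Filter.univ_mem,
          by simp⟩ ?_
      rintro ψ q' hψ - - ⟨D, F, h1, h2, h3, h4, h5⟩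
      obtain ⟨D', F', k1, k2, k3, k4, k5⟩ := hqp hψ
      refine ⟨D' ∩ D, F' ∪ F, k1.inter h1, ?_, k3.inter h3, Filter.inter_mem k4 h4, ?_⟩
      · rw [Finset.coe_union]
        exact Set.union_subset k2 h2
      · rintro t ⟨ht', ht⟩ χ (rfl | hχ)
        · exact (k5 t).2 ht'
        · exact h5 t ht χ hχ
    -- Finite satisfiability: the projection of D along i contains D, hence is U-large, and its
    -- support avoids i, so x already lies in it.
    obtain ⟨D, F, h1, h2, h3, h4, h5⟩ := this
    obtain ⟨t, ht⟩ := hx _ (h1.exists_update i) (F.erase i) (fun j hj => by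
      rw [Finset.mem_coe, Finset.mem_erase] at hj
      exact (h2 hj.2).resolve_left hj.1) (h3.exists_update i)
      (Filter.mem_of_superset h4 fun z hz => ⟨z i, by simpa using hz⟩)
    exact ⟨t, h5 t ht⟩)
  have hext : P (insert i S, Function.update x i t) := by
    intro D hD F hF hDF hDU
    obtain ⟨ψ, hψ⟩ := hD.preimage (B := A') Set.subset_union_left
      (isTermMap_update Set.subset_union_right i)
    have key : ∀ t, ψ.Realize (withParams A' fun _ => t) ↔ Function.update x i t ∈ D :=
      fun t => (Set.ext_iff.1 hψ fun _ => t).symm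
    exact (key t).1 (ht ψ ⟨D, F, hD, hF, hDF, hDU, key⟩)
  have := (hmax ⟨_, hext⟩ ⟨Set.subset_insert i S, fun j hj => by
    have : j ≠ i := fun h => hi (h ▸ hj)
    simp [this]⟩).1
  exact hi (this (Set.mem_insert i S))

end DefinableSets
-- Type-closed sets: projections, change of parameters, separation
section TypeClosed

variable {L : MSLang.{u}} {M : L.Srt → Type u} [L.Str M] {ι ι' : Type u} {s : ι → L.Srt}
  {s' : ι' → L.Srt} {A B : Set (Σ t, M t)} {Z Z' : Set (∀ i, M (s i))} {κ : Cardinal.{u}}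

/-- Intersections of arbitrarily many sets definable over `A`. -/
def TypeClosed (A : Set (Σ t, M t)) (Z : Set (∀ i, M (s i))) : Prop :=
  ∀ y, (∀ D, DefinableOver A D → Z ⊆ D → y ∈ D) → y ∈ Z

theorem TypeClosed.mono (hAB : A ⊆ B) (h : TypeClosed A Z) : TypeClosed B Z :=
  fun y hy => h y fun D hD hZ => hy D (hD.mono hAB) hZ

theorem DefinableOver.typeClosed (h : DefinableOver A Z) : TypeClosed A Z :=
  fun _ hy => hy Z h subset_rfl

theorem typeClosed_sInter {𝒵 : Set (Set (∀ i, M (s i)))} (h : ∀ Z ∈ 𝒵, TypeClosed A Z) :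
    TypeClosed A (⋂₀ 𝒵) :=
  fun y hy Z hZ => h Z hZ y fun D hD hZD => hy D hD ((Set.sInter_subset_of_mem hZ).trans hZD)

theorem TypeClosed.inter (h : TypeClosed A Z) (h' : TypeClosed A Z') : TypeClosed A (Z ∩ Z') := by
  rw [← Set.sInter_pair]
  exact typeClosed_sInter (by simp [h, h'])

theorem TypeClosed.union (h : TypeClosed A Z) (h' : TypeClosed A Z') : TypeClosed A (Z ∪ Z') := by
  intro y hy
  by_contra hyn
  rw [Set.mem_union, not_or] at hyn
  have h1 : ∃ D, DefinableOver A D ∧ Z ⊆ D ∧ y ∉ D := by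
    by_contra! hc
    exact hyn.1 (h y hc)
  have h2 : ∃ D, DefinableOver A D ∧ Z' ⊆ D ∧ y ∉ D := by
    by_contra! hc
    exact hyn.2 (h' y hc)
  obtain ⟨D, hD, hZ, hyD⟩ := h1
  obtain ⟨D', hD', hZ', hyD'⟩ := h2
  exact (hy _ (hD.union hD') (Set.union_subset_union hZ hZ')).elim hyD hyD'

theorem TypeClosed.preimage (hAB : A ⊆ B) (hZ : TypeClosed A Z)
    {f : (∀ i, M (s' i)) → ∀ i, M (s i)} (hf : IsTermMap B f) : TypeClosed B (f ⁻¹' Z) :=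
  fun y hy => hZ (f y) fun _ hD hZD => hy _ (hD.preimage hAB hf) (Set.preimage_mono hZD)

theorem typeClosed_sameType {f g : (∀ i, M (s' i)) → ∀ i, M (s i)} (hf : IsTermMap B f)
    (hg : IsTermMap B g) : TypeClosed B {z | SameType (f z) (g z)} := by
  intro y hy
  rw [Set.mem_ofPred_eq, sameType_iff]
  intro D hD
  have hf' := hD.preimage (Set.empty_subset B) hf
  have hg' := hD.preimage (Set.empty_subset B) hg
  have h1 := hy _ (hf'.compl.union hg') fun z hz => by
    by_cases hzD : f z ∈ D
    · exact .inr ((sameType_iff.1 hz D hD).1 hzD)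
    · exact .inl hzD
  have h2 := hy _ (hg'.compl.union hf') fun z hz => by
    by_cases hzD : g z ∈ D
    · exact .inr ((sameType_iff.1 hz D hD).2 hzD)
    · exact .inl hzD
  exact ⟨fun h => h1.resolve_left (not_not.2 h), fun h => h2.resolve_left (not_not.2 h)⟩

theorem TypeDefinableOver.typeClosed (h : TypeDefinableOver κ A Z) : TypeClosed A Z := by
  obtain ⟨𝒟, -, h, rfl⟩ := h
  exact typeClosed_sInter fun D hD => (h D hD).typeClosed

/-- The family of all A-definable supersets is small because there are fewer than κ formulas over A.
-/
theorem TypeClosed.typeDefinableOver (hM : IsMonster L M κ) (hA : #A < κ) (hι : #ι < κ)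
    (h : TypeClosed A Z) : TypeDefinableOver κ A Z := by
  refine ⟨{D | DefinableOver A D ∧ Z ⊆ D}, ?_, fun D hD => hD.1, ?_⟩
  · have hform : #(L.Formula (paramSort s A)) < κ := by
      refine mk_formula_lt hM.uncountable hM.small_srt hM.small_fn hM.small_rel ?_
      simpa using add_lt_of_lt hM.uncountable.le hι hA
    refine (mk_le_mk_of_subset ?_).trans_lt ((mk_range_le
      (f := fun φ : L.Formula (paramSort s A) => {x | φ.Realize (withParams A x)})).trans_lt hform)
    rintro D ⟨⟨φ, rfl⟩, -⟩
    exact ⟨φ, rfl⟩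
  · exact Set.Subset.antisymm (fun z hz D hD => hD.2 hz) fun y hy => h y fun D hD hZ => hy D ⟨hD, hZ⟩

theorem TypeClosed.typeDefinable (hM : IsMonster L M κ) (hA : #A < κ) (hι : #ι < κ)
    (h : TypeClosed A Z) : TypeDefinable κ Z :=
  ⟨A, hA, h.typeDefinableOver hM hA hι⟩

theorem withParams_smul {σ : L.Aut M} (hσ : ∀ a ∈ A, σ • a.2 = a.2) (x : ∀ i, M (s i)) :
    withParams A (σ • x) = σ • withParams A x := by
  funext j
  rcases j with i | a
  · rfl
  · exact (hσ a.1 a.2).symm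

theorem DefinableOver.smul_mem_iff {D : Set (∀ i, M (s i))} (hD : DefinableOver A D)
    {σ : L.Aut M} (hσ : ∀ a ∈ A, σ • a.2 = a.2) (x : ∀ i, M (s i)) : σ • x ∈ D ↔ x ∈ D := by
  obtain ⟨φ, rfl⟩ := hD
  rw [Set.mem_ofPred_eq, withParams_smul hσ]
  exact sameType_smul σ _ φ

/-- Homogeneity is applied to the tuples extended by an enumeration of A. One implication suffices,
as definable sets are closed under complement. -/
theorem exists_aut (hM : IsMonster L M κ) (hA : #A < κ) (hι : #ι < κ) {x y : ∀ i, M (s i)}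
    (h : ∀ D, DefinableOver A D → x ∈ D → y ∈ D) :
    ∃ σ : L.Aut M, (∀ a ∈ A, σ • a.2 = a.2) ∧ σ • x = y := by
  obtain ⟨σ, hσ⟩ := hM.homogeneous (ι ⊕ A) (paramSort s A) (withParams A x) (withParams A y)
    (by simpa using add_lt_of_lt hM.uncountable.le hι hA) fun φ =>
      ⟨h _ ⟨φ, rfl⟩, not_imp_not.1 (h _ (DefinableOver.compl ⟨φ, rfl⟩))⟩
  exact ⟨σ, fun a ha => congrFun hσ (.inr ⟨a, ha⟩), funext fun i => congrFun hσ (.inl i)⟩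

/-- The image of a type-definable set under a map with definable graph is an intersection of sets
definable over any small set over which it is invariant. -/
theorem TypeClosed.image (hM : IsMonster L M κ) (hA : #A < κ) (hB : #B < κ) (hι : #ι < κ)
    (hι' : #ι' < κ) {Y : Set (∀ i, M (s' i))} (hY : TypeClosed B Y)
    {f : (∀ i, M (s' i)) → ∀ i, M (s i)} (hf : IsTermMap B f)
    (hinv : ∀ σ : L.Aut M, (∀ a ∈ A, σ • a.2 = a.2) → ∀ y ∈ Y, σ • f y ∈ f '' Y) :
    TypeClosed A (f '' Y) := by
  intro y hy
  -- If y lies in every A-definable superset of the image, then Y meets the preimage of every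
  -- A-definable set around y. A realization z of an ultrafilter containing all of these is in Y,
  -- and f z has the type of y over A, so an automorphism fixing A carries f z to y.
  obtain ⟨U, hYU, hU⟩ := exists_ultrafilter {S | ∃ D, DefinableOver A D ∧ y ∈ D ∧ S = f ⁻¹' D}
    ⟨_, definableOver_univ, trivial, rfl⟩ (by
      rintro _ ⟨D, hD, hyD, rfl⟩ _ ⟨D', hD', hyD', rfl⟩
      exact ⟨_, hD.inter hD', ⟨hyD, hyD'⟩, rfl⟩) Y (by
      rintro _ ⟨D, hD, hyD, rfl⟩
      by_contra hne
      refine hy Dᶜ hD.compl ?_ hyD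
      rintro _ ⟨z, hz, rfl⟩ hzD
      exact hne ⟨z, hzD, hz⟩)
  obtain ⟨z, hz⟩ := exists_realization hM.uncountable hM.saturated
    (mk_union_lt hM.uncountable hA hB) hι' U
  have hzY : z ∈ Y := hY z fun D hD hYD =>
    hz D (hD.mono Set.subset_union_right) (Filter.mem_of_superset hYU hYD)
  have hyz : ∀ D, DefinableOver A D → y ∈ D → f z ∈ D := fun D hD hyD =>
    hz _ ((hD.mono Set.subset_union_left).preimage subset_rfl fun i => by
      obtain ⟨t, ht⟩ := hf i
      refine ⟨t.subst fun j => match j with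
        | .inl i => .var (s := paramSort s' (A ∪ B)) (.inl i)
        | .inr b => .var (s := paramSort s' (A ∪ B)) (.inr ⟨b.1, .inr b.2⟩), fun z => ?_⟩
      rw [ht, Term.eval_subst]
      congr 1
      funext j
      rcases j with i | b <;> rfl) (hU _ ⟨D, hD, hyD, rfl⟩)
  obtain ⟨σ, hσ, hσz⟩ := exists_aut hM hA hι fun D hD h => by
    by_contra hn
    exact hyz _ hD.compl hn h
  rw [← hσz]
  exact hinv σ hσ z hzY

theorem TypeClosed.of_invariant (hM : IsMonster L M κ) (hA : #A < κ) (hB : #B < κ) (hι : #ι < κ)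
    (hZ : TypeClosed B Z) (hinv : ∀ σ : L.Aut M, (∀ a ∈ A, σ • a.2 = a.2) → ∀ z ∈ Z, σ • z ∈ Z) :
    TypeClosed A Z := by
  have := hZ.image hM hA hB hι hι isTermMap_id (by simpa using hinv)
  simpa using this

/-- Compactness: otherwise some ultrafilter contains Z' and all A-definable supersets of Z, and its
realization lies in both sets. -/
theorem TypeClosed.exists_separation (hM : IsMonster L M κ) (hA : #A < κ) (hι : #ι < κ)
    (hZ : TypeClosed A Z) (hZ' : TypeClosed A Z') (hdisj : Disjoint Z Z') :
    ∃ D, DefinableOver A D ∧ Z ⊆ D ∧ Disjoint D Z' := by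
  by_contra! hc
  obtain ⟨U, hU', hU⟩ := exists_ultrafilter {D | DefinableOver A D ∧ Z ⊆ D}
    ⟨definableOver_univ, Set.subset_univ _⟩
    (fun D hD D' hD' => ⟨hD.1.inter hD'.1, Set.subset_inter hD.2 hD'.2⟩) Z'
    (fun D hD => Set.not_disjoint_iff_nonempty_inter.1 (hc D hD.1 hD.2))
  obtain ⟨z, hz⟩ := exists_realization hM.uncountable hM.saturated hA hι U
  exact Set.disjoint_left.1 hdisj (hZ z fun D hD hZD => hz D hD (hU D ⟨hD, hZD⟩))
    (hZ' z fun D hD hZD => hz D hD (Filter.mem_of_superset hU' hZD))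

end TypeClosed

/-! ### Elementary submodels and coheirs -/

section Coheir

variable {L : MSLang.{u}} {M : L.Srt → Type u} [L.Str M] {ι ν : Type u} {s : ι → L.Srt}
  {r : ν → L.Srt} {N : Substr L M} {A : Set (Σ t, M t)}

/-- The Tarski–Vaught criterion, with the parameters of the formula turned into free variables. -/
theorem Substr.IsElementary.exists_mem (hN : N.IsElementary) (hA : ∀ a ∈ A, a.2 ∈ N.carrier a.1)
    {t : L.Srt} {D : Set (PUnit.{u + 1} → M t)}
    (hD : DefinableOver (s := fun _ : PUnit.{u + 1} => t) A D) (hne : D.Nonempty) :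
    ∃ x ∈ N.carrier t, (fun _ => x) ∈ D := by
  obtain ⟨ψ, rfl⟩ := hD
  obtain ⟨y, hy⟩ := hne
  let v : ∀ a : A, N.carrier a.1.1 := fun a => ⟨a.1.2, hA a.1 a.2⟩
  have h1 : ψ.exists_.Realize fun a => ((v a).1 : M _) := by
    rw [Formula.realize_exists_]
    refine ⟨y ⟨⟩, ?_⟩
    refine (congrArg _ (funext fun j => ?_)).mpr hy
    rcases j with _ | a <;> rfl
  rw [← hN, Formula.realize_exists_] at h1
  obtain ⟨x, hx⟩ := h1
  rw [hN] at hx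
  refine ⟨x.1, x.2, ?_⟩
  refine (congrArg (Formula.Realize ψ) (funext fun j => ?_)).mpr hx
  rcases j with _ | a <;> rfl

/-- Only finitely many coordinates matter: one is projected away, the rest are found in N by
induction, and the last is chosen in N by Tarski–Vaught. Coordinates outside the support take
arbitrary values in N. -/
theorem Substr.IsElementary.exists_mem_of_definable (hN : N.IsElementary)
    {D : Set (∀ i, M (s i))} (hD : DefinableOver {a : Σ t, M t | a.2 ∈ N.carrier a.1} D)
    (hne : D.Nonempty) : ∃ z ∈ D, ∀ i, z i ∈ N.carrier (s i) := by
  classical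
  obtain ⟨F, hF⟩ := hD.exists_supportedOn
  induction F using Finset.induction_on generalizing D with
  | empty =>
    obtain ⟨z, hz⟩ := hne
    have : ∀ i, ∃ x, x ∈ N.carrier (s i) := fun i => by
      obtain ⟨x, hx, -⟩ := hN.exists_mem (A := {a : Σ t, M t | a.2 ∈ N.carrier a.1})
        (fun _ h => h) (definableOver_univ (s := fun _ : PUnit.{u + 1} => s i)) ⟨fun _ => z i, trivial⟩
      exact ⟨x, hx⟩
    choose w hw using this
    exact ⟨w, hF.mem_of_empty hz w, hw⟩
  | insert i F hi ih =>
    obtain ⟨z, ⟨x, hx⟩, hzN⟩ := ih (hD.exists_update i)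
      (hne.imp fun z hz => ⟨z i, by simpa using hz⟩)
      (by simpa [Finset.erase_insert hi] using hF.exists_update i)
    obtain ⟨y, hyN, hy⟩ := hN.exists_mem (fun _ h => h) (hD.preimage subset_rfl
      (isTermMap_update (x := z) (by rintro _ ⟨j, rfl⟩; exact hzN j) i)) ⟨fun _ => x, hx⟩
    refine ⟨_, hy, fun j => ?_⟩
    by_cases h : j = i
    · subst h
      simpa using hyN
    · simpa [h] using hzN j

/-- An N-definable set containing x has a point in N, so the type of x over N extends to an
ultrafilter concentrated on tuples from N. -/
theorem Substr.IsElementary.exists_coheir (hN : N.IsElementary) (x : ∀ i, M (s i)) :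
    ∃ U : Ultrafilter (∀ i, M (s i)), {z | ∀ i, z i ∈ N.carrier (s i)} ∈ U ∧
      ∀ D, DefinableOver {a : Σ t, M t | a.2 ∈ N.carrier a.1} D → x ∈ D → D ∈ U := by
  obtain ⟨U, h1, h2⟩ := exists_ultrafilter
    {D | DefinableOver {a : Σ t, M t | a.2 ∈ N.carrier a.1} D ∧ x ∈ D}
    ⟨definableOver_univ, trivial⟩ (fun D hD D' hD' => ⟨hD.1.inter hD'.1, hD.2, hD'.2⟩)
    {z | ∀ i, z i ∈ N.carrier (s i)} (fun D hD => hN.exists_mem_of_definable hD.1 ⟨x, hD.2⟩)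
  exact ⟨U, h1, fun D hD hx => h2 D ⟨hD, hx⟩⟩

theorem isTermMap_pair_left {B : Set (Σ t, M t)} {x : ∀ i, M (s i)} (hx : entries x ⊆ B) :
    IsTermMap B fun y : ∀ i, M (s i) => pair x y := by
  rintro (i | i)
  · exact isTermMap_const hx i
  · exact isTermMap_id i

theorem isTermMap_pair_right {B : Set (Σ t, M t)} {x : ∀ i, M (s i)} (hx : entries x ⊆ B) :
    IsTermMap B fun y : ∀ i, M (s i) => pair y x := by
  rintro (i | i)
  · exact isTermMap_id i
  · exact isTermMap_const hx i

/-- Whether (w, z) ∈ D is decided by U-almost all n in N, and for such n the condition (w, n) ∈ D is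
an N-definable condition on w, on which w and w' agree. -/
theorem sameType_pair_of_coheir {U : Ultrafilter (∀ i, M (s i))}
    (hU : {z | ∀ i, z i ∈ N.carrier (s i)} ∈ U) {B : Set (Σ t, M t)} {w w' z : ∀ i, M (s i)}
    (hww' : ∀ D, DefinableOver {a : Σ t, M t | a.2 ∈ N.carrier a.1} D → (w ∈ D ↔ w' ∈ D))
    (hz : ∀ D, DefinableOver B D → D ∈ U → z ∈ D) (hw : entries w ⊆ B) (hw' : entries w' ⊆ B) :
    SameType (pair w z) (pair w' z) := by
  rw [sameType_iff]
  intro D hD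
  have key : ∀ {w}, entries w ⊆ B → (pair w z ∈ D ↔ {n | pair w n ∈ D} ∈ U) := by
    intro w hw
    have hDw := hD.preimage (Set.empty_subset B) (isTermMap_pair_left hw)
    refine ⟨fun h => ?_, fun h => hz _ hDw h⟩
    by_contra hn
    exact hz _ hDw.compl (Ultrafilter.compl_mem_iff_notMem.2 hn) h
  rw [key hw, key hw']
  have hn : ∀ n ∈ {z : ∀ i, M (s i) | ∀ i, z i ∈ N.carrier (s i)},
      (pair w n ∈ D ↔ pair w' n ∈ D) := fun n hn =>
    hww' _ (hD.preimage (Set.empty_subset _) (isTermMap_pair_right (x := n) (by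
      rintro _ ⟨i, rfl⟩
      exact hn i)))
  exact ⟨fun h => Filter.mem_of_superset (Filter.inter_mem hU h) fun n h => (hn n h.1).1 h.2,
    fun h => Filter.mem_of_superset (Filter.inter_mem hU h) fun n h => (hn n h.1).2 h.2⟩

end Coheir

/-! ### Automorphisms over a model and Lascar strong automorphisms -/

section Lascar

variable {L : MSLang.{u}} {M : L.Srt → Type u} [L.Str M] {ι ν : Type u} {s : ι → L.Srt}
  {r : ν → L.Srt} {κ : Cardinal.{u}} {X : Set (∀ i, M (s i))} {E : Setoid X}

theorem RelInvariant.smul_mem (hinv : RelInvariant E) (σ : L.Aut M) (x : X) : σ • x.1 ∈ X :=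
  (hinv σ x x (E.refl x)).1

theorem RelInvariant.of_smul (hinv : RelInvariant E) {σ : L.Aut M} {x y x' y' : X}
    (hx : σ • x.1 = x'.1) (hy : σ • y.1 = y'.1) (h : E x y) : E x' y' := by
  obtain ⟨h1, h2, h3⟩ := hinv σ x y h
  convert h3 using 1
  · exact Subtype.ext hx.symm
  · exact Subtype.ext hy.symm

theorem RelInvariant.rel_smul (hinv : RelInvariant E) (σ : L.Aut M) {x y : X} (h : E x y) :
    E ⟨σ • x.1, hinv.smul_mem σ x⟩ ⟨σ • y.1, hinv.smul_mem σ y⟩ :=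
  hinv.of_smul rfl rfl h

theorem forall_entries_smul_iff {m : ∀ i, M (r i)} {σ : L.Aut M} :
    (∀ a ∈ entries m, σ • a.2 = a.2) ↔ σ • m = m :=
  ⟨fun h => funext fun i => h _ ⟨i, rfl⟩, by
    rintro h _ ⟨i, rfl⟩
    exact congrFun h i⟩

/-- Automorphisms fixing a small elementary submodel preserve the classes of bounded invariant
equivalence relations. -/
theorem RelInvariant.rel_smul_of_smul_eq (hinv : RelInvariant E) (hM : IsMonster L M κ)
    (hι : #ι < κ) (hbdd : RelBounded κ E) {m : ∀ i, M (r i)} (hm : EnumeratesSmallModel κ m)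
    {σ : L.Aut M} (hσ : σ • m = m) (x : X) : E x ⟨σ • x.1, hinv.smul_mem σ x⟩ := by
  classical
  obtain ⟨hν, N, hN, hmN⟩ := hm
  set A : Set (Σ t, M t) := {a : Σ t, M t | a.2 ∈ N.carrier a.1} with hAdef
  have hA : #A < κ := hmN ▸ mk_range_le.trans_lt hν
  set y : X := ⟨σ • x.1, hinv.smul_mem σ x⟩ with hy
  have hxy : ∀ D, DefinableOver A D → (y.1 ∈ D ↔ x.1 ∈ D) := fun D hD =>
    hD.smul_mem_iff (by rw [← hmN]; exact forall_entries_smul_iff.2 hσ) x.1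
  -- Choose a representative in each class meeting the type of x over N; x is a dummy value for the
  -- other classes. Boundedness keeps the set C of all their entries small.
  have hc : ∀ q : Quotient E, ∃ c : X, (∀ D, DefinableOver A D → (c.1 ∈ D ↔ x.1 ∈ D)) ∧
      ∀ w : X, ⟦w⟧ = q → (∀ D, DefinableOver A D → (w.1 ∈ D ↔ x.1 ∈ D)) → E c w := by
    intro q
    by_cases h : ∃ w : X, ⟦w⟧ = q ∧ ∀ D, DefinableOver A D → (w.1 ∈ D ↔ x.1 ∈ D)
    · obtain ⟨c, hcq, hc⟩ := h
      exact ⟨c, hc, fun w hw _ => Quotient.exact (hcq.trans hw.symm)⟩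
    · exact ⟨x, fun _ _ => Iff.rfl, fun w hw hw' => (h ⟨w, hw, hw'⟩).elim⟩
  choose c hcx hcE using hc
  let C : Set (Σ t, M t) := Set.range fun p : Quotient E × ι => ⟨s p.2, (c p.1).1 p.2⟩
  have hC : #C < κ := by
    refine mk_range_le.trans_lt ?_
    simpa using mul_lt_of_lt hM.uncountable.le hbdd hι
  let B := (A ∪ C) ∪ (entries x.1 ∪ entries y.1)
  have hB : #B < κ := mk_union_lt hM.uncountable (mk_union_lt hM.uncountable hA hC)
    (mk_union_lt hM.uncountable (mk_entries_lt hι _) (mk_entries_lt hι _))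
  have hAB : A ⊆ B := Set.subset_union_left.trans Set.subset_union_left
  obtain ⟨U, hUN, hUx⟩ := hN.exists_coheir x.1
  -- The coheir is realized over a set containing all representatives together with x and σx. The
  -- class of z has a representative c in that set; for any w there with the type of x over N, (c,
  -- z) ≡ (w, z), so invariance turns c E z into w E z. Taking w = x and w = σx finishes.
  obtain ⟨z, hz⟩ := exists_realization hM.uncountable hM.saturated hB hι U
  have hxz : ∀ D, DefinableOver A D → x.1 ∈ D → z ∈ D := fun D hD h =>
    hz D (hD.mono hAB) (hUx D hD h)
  obtain ⟨τ, -, hτ⟩ := exists_aut hM hA hι hxz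
  have hzX : z ∈ X := hτ ▸ hinv.smul_mem τ x
  let q : Quotient E := ⟦⟨z, hzX⟩⟧
  have hcz : E (c q) ⟨z, hzX⟩ := hcE q _ rfl fun D hD =>
    ⟨fun h => by_contra fun hn => hxz _ hD.compl hn h, hxz D hD⟩
  have hcB : entries (c q).1 ⊆ B := by
    rintro _ ⟨i, rfl⟩
    exact .inl (.inr ⟨(q, i), rfl⟩)
  have key : ∀ w : X, (∀ D, DefinableOver A D → (w.1 ∈ D ↔ x.1 ∈ D)) → entries w.1 ⊆ B →
      E w ⟨z, hzX⟩ := by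
    intro w hwx hwB
    obtain ⟨ρ, hρ⟩ := hM.homogeneous _ _ (pair (c q).1 z) (pair w.1 z)
      (by simpa using add_lt_of_lt hM.uncountable.le hι hι)
      (sameType_pair_of_coheir hUN (fun D hD => (hcx q D hD).trans (hwx D hD).symm) hz hcB hwB)
    exact hinv.of_smul (funext fun i => congrFun hρ (.inl i))
      (funext fun i => congrFun hρ (.inr i)) hcz
  exact E.trans (key x (fun _ _ => Iff.rfl) (Set.subset_union_left.trans Set.subset_union_right))
    (E.symm (key y hxy (Set.subset_union_right.trans Set.subset_union_right)))

/-- An automorphism moving an enumeration of a small elementary submodel within its `≡_L`-class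
preserves the classes of bounded invariant equivalence relations. -/
theorem RelInvariant.rel_smul_of_lascar (hinv : RelInvariant E) (hM : IsMonster L M κ)
    (hι : #ι < κ) (hbdd : RelBounded κ E) {m : ∀ i, M (r i)} (hm : EnumeratesSmallModel κ m)
    {ρ : L.Aut M} (hρ : lascar κ r (ρ • m) m) (x : X) :
    E x ⟨ρ • x.1, hinv.smul_mem ρ x⟩ := by
  classical
  -- The map σm ↦ [σx] is well defined because automorphisms fixing m preserve classes. Sending
  -- tuples outside the orbit of m to `none` makes its kernel a bounded invariant relation on the
  -- whole product, hence coarser than ≡_L.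
  let g : (∀ i, M (r i)) → Option (Quotient E) := fun n =>
    if h : ∃ σ : L.Aut M, σ • m = n then some ⟦⟨h.choose • x.1, hinv.smul_mem _ x⟩⟧ else none
  have hg : ∀ σ : L.Aut M, g (σ • m) = some ⟦⟨σ • x.1, hinv.smul_mem σ x⟩⟧ := by
    intro σ
    have h : ∃ τ : L.Aut M, τ • m = σ • m := ⟨σ, rfl⟩
    simp only [g, dif_pos h]
    refine congrArg _ (Quotient.sound ?_)
    have h1 : (σ⁻¹ * h.choose) • m = m := by rw [mul_smul, h.choose_spec, inv_smul_smul]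
    have h2 : σ • (σ⁻¹ * h.choose) • x.1 = h.choose • x.1 := by rw [← mul_smul, mul_inv_cancel_left]
    exact E.symm (hinv.of_smul (σ := σ) rfl h2 (hinv.rel_smul_of_smul_eq hM hι hbdd hm h1 x))
  have hgn : ∀ n, (¬ ∃ σ : L.Aut M, σ • m = n) → g n = none := fun n h => dif_neg h
  have hgσ : ∀ (σ : L.Aut M) (n n' : ∀ i, M (r i)), g n = g n' → g (σ • n) = g (σ • n') := by
    intro σ n n' h
    by_cases hn : ∃ τ : L.Aut M, τ • m = n
    · by_cases hn' : ∃ τ : L.Aut M, τ • m = n'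
      · obtain ⟨τ, rfl⟩ := hn
        obtain ⟨τ', rfl⟩ := hn'
        rw [hg, hg, Option.some_inj] at h
        have h' := hinv.rel_smul σ (Quotient.exact h)
        simp only [← mul_smul, hg] at h' ⊢
        exact congrArg _ (Quotient.sound h')
      · obtain ⟨τ, rfl⟩ := hn
        rw [hg, hgn n' hn'] at h
        simp at h
    · by_cases hn' : ∃ τ : L.Aut M, τ • m = n'
      · obtain ⟨τ, rfl⟩ := hn'
        rw [hg, hgn n hn] at h
        simp at h
      · have hout : ∀ n, (¬ ∃ τ : L.Aut M, τ • m = n) → g (σ • n) = none := by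
          intro n hn
          refine hgn _ ?_
          rintro ⟨τ, hτ⟩
          exact hn ⟨σ⁻¹ * τ, by rw [mul_smul, hτ, inv_smul_smul]⟩
        rw [hout n hn, hout n' hn']
  let F : Setoid (Set.univ : Set (∀ i, M (r i))) := Setoid.ker fun n => g n.1
  have hF : RelInvariant F := fun σ n n' h => ⟨trivial, trivial, hgσ σ n.1 n'.1 h⟩
  have hFb : RelBounded κ F := by
    have h1 : #(Quotient F) ≤ #(Option (Quotient E)) :=
      mk_le_of_injective (Setoid.kerLift_injective _)
    refine h1.trans_lt ?_
    rw [mk_option]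
    exact add_lt_of_lt hM.uncountable.le hbdd (one_lt_aleph0.trans hM.uncountable)
  have h : g (ρ • m) = g m := hρ F hF hFb
  have h1 := hg 1
  simp only [one_smul] at h1
  rw [hg, h1, Option.some_inj] at h
  exact E.symm (Quotient.exact h)

/-- Being Lascar strong can be tested on a single model, by applying the preceding lemma to every
bounded invariant relation on every small product. -/
theorem mem_Autf_iff (hM : IsMonster L M κ) {m : ∀ i, M (r i)} (hm : EnumeratesSmallModel κ m)
    {ρ : L.Aut M} : ρ ∈ Autf L M κ ↔ lascar κ r (ρ • m) m := by
  refine ⟨fun h => h ν r m hm.1, fun h ι s x hι => (lascar κ s).symm fun E hinv hbdd => ?_⟩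
  exact hinv.rel_smul_of_lascar hM hι hbdd hm h ⟨x, trivial⟩

end Lascar
-- Preimages of sets of classes
section ClassPreimage

variable {L : MSLang.{u}} {M : L.Srt → Type u} {ι : Type u} {s : ι → L.Srt}
  {X : Set (∀ i, M (s i))} {E : Setoid X}

/-- The preimage in `X` of a set of classes. -/
def classPreimage (E : Setoid X) (C : Set (Quotient E)) : Set (∀ i, M (s i)) :=
  {x | ∃ hx : x ∈ X, Quotient.mk E ⟨x, hx⟩ ∈ C}

theorem classPreimage_singleton (x : X) : classPreimage E {Quotient.mk E x} = relClass E x := by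
  ext y
  exact ⟨fun ⟨hy, h⟩ => ⟨hy, E.symm (Quotient.exact h)⟩,
    fun ⟨hy, h⟩ => ⟨hy, Quotient.sound (E.symm h)⟩⟩

end ClassPreimage

/-! ### The logic topology in terms of type-closed sets -/

section LogicTopology

variable {L : MSLang.{u}} {M : L.Srt → Type u} [L.Str M] {ι ν : Type u} {s : ι → L.Srt}
  {r : ν → L.Srt} {κ : Cardinal.{u}} {X : Set (∀ i, M (s i))} {E : Setoid X}
  {A B : Set (Σ t, M t)}

/-- Automorphisms fixing `A` pointwise preserve the `E`-classes. -/
def ClassesInvariant (A : Set (Σ t, M t)) (E : Setoid X) : Prop :=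
  ∀ σ : L.Aut M, (∀ a ∈ A, σ • a.2 = a.2) → ∀ x : X, ∃ h : σ • x.1 ∈ X, E x ⟨σ • x.1, h⟩

theorem ClassesInvariant.smul_mem_classPreimage (hE : ClassesInvariant A E) {σ : L.Aut M}
    (hσ : ∀ a ∈ A, σ • a.2 = a.2) {C : Set (Quotient E)} {x : ∀ i, M (s i)}
    (hx : x ∈ classPreimage E C) : σ • x ∈ classPreimage E C := by
  obtain ⟨hx, hxC⟩ := hx
  obtain ⟨h1, h2⟩ := hE σ hσ ⟨x, hx⟩
  exact ⟨h1, (Quotient.sound h2 : Quotient.mk E _ = _) ▸ hxC⟩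

/-- A union of classes is invariant over A, so whatever parameters define it can be replaced by A.
-/
theorem typeDefinable_classPreimage_iff (hM : IsMonster L M κ) (hι : #ι < κ) (hA : #A < κ)
    (hE : ClassesInvariant A E) (C : Set (Quotient E)) :
    TypeDefinable κ (classPreimage E C) ↔ TypeClosed A (classPreimage E C) := by
  refine ⟨?_, fun h => h.typeDefinable hM hA hι⟩
  rintro ⟨B, hB, h⟩
  exact h.typeClosed.of_invariant hM hA hB hι fun σ hσ z hz => hE.smul_mem_classPreimage hσ hz

/-- With a common parameter set A, the sets with type-closed preimage are stable under finite unions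
and arbitrary intersections, so generating a topology adds no closed sets. -/
theorem isClosed_logicTopology_iff (hM : IsMonster L M κ) (hι : #ι < κ) (hA : #A < κ)
    (hX : TypeClosed A X) (hE : ClassesInvariant A E) (C : Set (Quotient E)) :
    IsClosed[logicTopology κ E] C ↔ TypeClosed A (classPreimage E C) := by
  rw [← @isOpen_compl_iff _ _ (logicTopology κ E)]
  constructor
  · suffices h : ∀ U, IsOpen[logicTopology κ E] U → TypeClosed A (classPreimage E Uᶜ) by
      intro hC
      simpa using h _ hC
    intro U hU
    induction hU with
    | basic U hU => exact (typeDefinable_classPreimage_iff hM hι hA hE _).1 hU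
    | univ =>
      have : classPreimage E (Set.univᶜ) = ∅ := by
        ext x
        simp [classPreimage]
      rw [this]
      exact definableOver_empty.typeClosed
    | inter U V _ _ hU hV =>
      have : classPreimage E (U ∩ V)ᶜ = classPreimage E Uᶜ ∪ classPreimage E Vᶜ := by
        ext x
        simp only [classPreimage, Set.mem_ofPred_eq, Set.mem_union, Set.compl_inter, exists_or]
      rw [this]
      exact hU.union hV
    | sUnion S _ hS =>
      -- The factor X is needed when S is empty.
      have : classPreimage E (⋃₀ S)ᶜ = X ∩ ⋂₀ ((fun U => classPreimage E Uᶜ) '' S) := by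
        ext x
        constructor
        · rintro ⟨hx, hxS⟩
          refine ⟨hx, ?_⟩
          rintro _ ⟨U, hU, rfl⟩
          exact ⟨hx, fun h => hxS ⟨U, hU, h⟩⟩
        · rintro ⟨hx, hxS⟩
          refine ⟨hx, ?_⟩
          rintro ⟨U, hU, h⟩
          exact (hxS _ ⟨U, hU, rfl⟩).2 h
      rw [this]
      refine hX.inter (typeClosed_sInter ?_)
      rintro _ ⟨U, hU, rfl⟩
      exact hS U hU
  · intro h
    refine TopologicalSpace.GenerateOpen.basic _ ?_
    change TypeDefinable κ (classPreimage E Cᶜᶜ)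
    rw [compl_compl]
    exact h.typeDefinable hM hA hι

theorem RelInvariant.classesInvariant (hinv : RelInvariant E) (hM : IsMonster L M κ)
    (hι : #ι < κ) (hbdd : RelBounded κ E) {m : ∀ i, M (r i)} (hm : EnumeratesSmallModel κ m) :
    ClassesInvariant (entries m) E := fun σ hσ x =>
  ⟨hinv.smul_mem σ x, hinv.rel_smul_of_smul_eq hM hι hbdd hm (forall_entries_smul_iff.1 hσ) x⟩

end LogicTopology

/-! ### Closed subgroups of the Galois group as type-closed orbits of m -/

section GaloisGroup

variable {L : MSLang.{u}} {M : L.Srt → Type u} [L.Str M] {ν : Type u}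
  {r : ν → L.Srt} {κ : Cardinal.{u}} {m : ∀ i, M (r i)}

theorem exists_smul_eq_of_sameType (hM : IsMonster L M κ) (hν : #ν < κ) {n : ∀ i, M (r i)}
    (h : SameType n m) : ∃ σ : L.Aut M, σ • m = n :=
  hM.homogeneous ν r m n hν fun φ => (h φ).symm

theorem classesInvariant_lascarOn (hM : IsMonster L M κ) (hm : EnumeratesSmallModel κ m) :
    ClassesInvariant (entries m) (lascarOn κ m) := fun σ hσ n =>
  ⟨fun φ => (sameType_smul σ n.1 φ).trans (n.2 φ), fun _ hinv hbdd =>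
    hinv.rel_smul_of_smul_eq hM hm.1 hbdd hm (forall_entries_smul_iff.1 hσ) ⟨n.1, trivial⟩⟩

theorem typeClosed_typeSet (m : ∀ i, M (r i)) : TypeClosed (entries m) (typeSet m) :=
  typeClosed_sameType isTermMap_id (isTermMap_const subset_rfl)

theorem lascar_smul_smul_iff (hM : IsMonster L M κ) (hm : EnumeratesSmallModel κ m)
    {σ τ : L.Aut M} : lascar κ r (σ • m) (τ • m) ↔ τ⁻¹ * σ ∈ Autf L M κ := by
  rw [mem_Autf_iff hM hm, mul_smul]
  constructor
  · intro h
    simpa using lascar_smul τ⁻¹ h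
  · intro h
    simpa using lascar_smul τ h

/-- A subgroup containing `Autf` is a union of fibres of σ ↦ [σm], so it is recovered from its
image. -/
theorem galMap_mk_eq_iff (hM : IsMonster L M κ) (hm : EnumeratesSmallModel κ m)
    {Γ : Subgroup (L.Aut M)} (hΓ : Autf L M κ ≤ Γ) (σ : L.Aut M) :
    galMap κ m hm.1 (QuotientGroup.mk σ) ∈
      (fun γ : L.Aut M => galMap κ m hm.1 (QuotientGroup.mk γ)) '' Γ ↔ σ ∈ Γ := by
  refine ⟨?_, fun h => ⟨σ, h, rfl⟩⟩
  rintro ⟨γ, hγ, h⟩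
  have h0 : lascarOn κ m ⟨γ • m, sameType_smul γ m⟩ ⟨σ • m, sameType_smul σ m⟩ :=
    Quotient.exact h
  have h1 : lascar κ r (γ • m) (σ • m) := h0
  have h2 := Γ.mul_mem hγ (Γ.inv_mem (hΓ ((lascar_smul_smul_iff hM hm).1 h1)))
  simpa using h2

/-- By homogeneity every realization of the type of m is some σm, so the preimage in that type of
the classes corresponding to Γ is exactly the orbit Γm. -/
theorem isPreimageOfClosed_iff (hM : IsMonster L M κ) (hm : EnumeratesSmallModel κ m)
    (Γ : Subgroup (L.Aut M)) : IsPreimageOfClosed κ m hm Γ ↔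
      Autf L M κ ≤ Γ ∧ TypeClosed (entries m) ((fun σ : L.Aut M => σ • m) '' Γ) := by
  have hclosed := isClosed_logicTopology_iff hM hm.1 (mk_entries_lt hm.1 m)
    (typeClosed_typeSet m) (classesInvariant_lascarOn hM hm)
  have hpre : ∀ C : Set (Quotient (lascarOn κ m)),
      (∀ σ : L.Aut M, galMap κ m hm.1 (QuotientGroup.mk σ) ∈ C ↔ σ ∈ Γ) →
      classPreimage (lascarOn κ m) C = (fun σ : L.Aut M => σ • m) '' Γ := by
    intro C hC
    ext n
    constructor
    · rintro ⟨hn, hnC⟩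
      obtain ⟨σ, rfl⟩ := exists_smul_eq_of_sameType hM hm.1 hn
      exact ⟨σ, (hC σ).1 hnC, rfl⟩
    · rintro ⟨σ, hσ, rfl⟩
      exact ⟨sameType_smul σ m, (hC σ).2 hσ⟩
  constructor
  · rintro ⟨K, hK, rfl⟩
    obtain ⟨C, hC, hCK⟩ := (@isClosed_induced_iff _ _ (logicTopology κ (lascarOn κ m)) _ _).1 hK
    refine ⟨fun σ hσ => ?_, ?_⟩
    · rw [Subgroup.mem_comap, QuotientGroup.mk'_apply, (QuotientGroup.eq_one_iff σ).2 hσ]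
      exact K.one_mem
    · rw [← hpre C fun σ => ?_]
      · exact (hclosed C).1 hC
      · exact Set.ext_iff.1 hCK (QuotientGroup.mk σ)
  · rintro ⟨hΓ, h⟩
    let C := (fun γ : L.Aut M => galMap κ m hm.1 (QuotientGroup.mk γ)) '' Γ
    have hC := galMap_mk_eq_iff hM hm hΓ
    have hcomap : Γ = (Γ.map (QuotientGroup.mk' (Autf L M κ))).comap
        (QuotientGroup.mk' (Autf L M κ)) := by
      rw [Subgroup.comap_map_eq, QuotientGroup.ker_mk', sup_eq_left.2 hΓ]
    refine ⟨Γ.map (QuotientGroup.mk' (Autf L M κ)), ?_, hcomap⟩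
    refine (@isClosed_induced_iff _ _ (logicTopology κ (lascarOn κ m)) _ _).2
      ⟨C, (hclosed C).2 (by rwa [hpre C hC]), Set.ext fun q => ?_⟩
    obtain ⟨σ, rfl⟩ := QuotientGroup.mk_surjective q
    exact (hC σ).trans (iff_of_eq (congrArg (σ ∈ ·) hcomap))

end GaloisGroup

/-! ### The implications between the five conditions -/

section Orbital

variable {L : MSLang.{u}} {M : L.Srt → Type u} [L.Str M] {ι ν : Type u} {s : ι → L.Srt}
  {r : ν → L.Srt} {κ : Cardinal.{u}} {X : Set (∀ i, M (s i))} {E : Setoid X}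
  {A B : Set (Σ t, M t)} {m : ∀ i, M (r i)}

/-- The graph of `E`, as a set of concatenated tuples. -/
def relGraph (E : Setoid X) : Set (∀ j, M (Sum.elim s s j)) :=
  {z | ∃ x y : X, E x y ∧ z = pair x.1 y.1}

/-- The concatenation of two tuples of possibly different sorts. -/
def concat (n : ∀ i, M (r i)) (y : ∀ i, M (s i)) : ∀ j, M (Sum.elim r s j)
  | .inl i => n i
  | .inr i => y i

theorem smul_concat (σ : L.Aut M) (n : ∀ i, M (r i)) (y : ∀ i, M (s i)) :
    σ • concat n y = concat (σ • n) (σ • y) := by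
  funext j
  rcases j with i | i <;> rfl

theorem isTermMap_concat {ι' : Type u} {s' : ι' → L.Srt} {f : (∀ i, M (s' i)) → ∀ i, M (r i)}
    {g : (∀ i, M (s' i)) → ∀ i, M (s i)} (hf : IsTermMap B f) (hg : IsTermMap B g) :
    IsTermMap B fun z => concat (f z) (g z) := by
  rintro (i | i)
  · exact hf i
  · exact hg i

theorem isTermMap_fst : IsTermMap B fun (z : ∀ j, M (Sum.elim r s j)) i => (z (.inl i) : M (r i)) :=
  fun i => ⟨.var (s := paramSort (Sum.elim r s) B) (.inl (.inl i)), fun _ => rfl⟩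

theorem isTermMap_snd : IsTermMap B fun (z : ∀ j, M (Sum.elim r s j)) i => (z (.inr i) : M (s i)) :=
  fun i => ⟨.var (s := paramSort (Sum.elim r s) B) (.inl (.inr i)), fun _ => rfl⟩

/-- The saturation of F is the second projection of the part of the graph of E lying over F, and it
is invariant over A. -/
theorem ClassesInvariant.typeClosed_saturation (hM : IsMonster L M κ) (hι : #ι < κ) (hA : #A < κ)
    (hB : #B < κ) (hE : ClassesInvariant A E) (hR : TypeClosed B (relGraph E))
    {F : Set (∀ i, M (s i))} (hF : TypeClosed A F) :
    TypeClosed A (classPreimage E {q | ∃ x : X, Quotient.mk E x = q ∧ x.1 ∈ F}) := by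
  have hι2 : #(ι ⊕ ι) < κ := by simpa using add_lt_of_lt hM.uncountable.le hι hι
  let f : (∀ j, M (Sum.elim s s j)) → ∀ i, M (s i) :=
    fun z i => z (Sum.inr i)
  have heq : classPreimage E {q | ∃ x : X, Quotient.mk E x = q ∧ x.1 ∈ F} =
      f '' (relGraph E ∩ {z | (fun i => (z (.inl i) : M (s i))) ∈ F}) := by
    ext y
    constructor
    · rintro ⟨hy, x, hxy, hx⟩
      exact ⟨pair x.1 y, ⟨⟨x, ⟨y, hy⟩, Quotient.exact hxy, rfl⟩, hx⟩, rfl⟩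
    · rintro ⟨_, ⟨⟨x, y, hxy, rfl⟩, hx⟩, rfl⟩
      exact ⟨y.2, x, Quotient.sound hxy, hx⟩
  have hY : TypeClosed (A ∪ B) (relGraph E ∩ {z | (fun i => (z (.inl i) : M (s i))) ∈ F}) :=
    (hR.mono Set.subset_union_right).inter (hF.preimage Set.subset_union_left isTermMap_fst)
  rw [heq]
  refine hY.image hM hA (mk_union_lt hM.uncountable hA hB) hι hι2 isTermMap_snd ?_
  intro σ hσ z hz
  have : f z ∈ f '' _ := ⟨z, hz, rfl⟩
  rw [← heq] at this ⊢
  exact hE.smul_mem_classPreimage hσ this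

theorem ClassesInvariant.t2Space_of_typeClosed (hM : IsMonster L M κ) (hι : #ι < κ) (hA : #A < κ)
    (hB : #B < κ) (hX : TypeClosed A X) (hE : ClassesInvariant A E)
    (hR : TypeClosed B (relGraph E)) : @T2Space (Quotient E) (logicTopology κ E) := by
  let := logicTopology κ E
  have hclosed := isClosed_logicTopology_iff hM hι hA hX hE
  have hclass : ∀ x : X, TypeClosed A (relClass E x) := by
    intro x
    have h1 : relClass E x = (fun y => pair x.1 y) ⁻¹' relGraph E := by
      ext y
      constructor
      · rintro ⟨hy, h⟩
        exact ⟨x, ⟨y, hy⟩, h, rfl⟩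
      · rintro ⟨x', y', h, h'⟩
        have hx : x = x' := Subtype.ext (funext fun i => congrFun h' (.inl i))
        have hy : y = y'.1 := funext fun i => congrFun h' (.inr i)
        subst hx hy
        exact ⟨y'.2, h⟩
    have h2 : TypeClosed (B ∪ entries x.1) (relClass E x) := by
      rw [h1]
      exact hR.preimage Set.subset_union_left (isTermMap_pair_left Set.subset_union_right)
    rw [← classPreimage_singleton] at h2 ⊢
    exact h2.of_invariant hM hA (mk_union_lt hM.uncountable hB (mk_entries_lt hι _)) hι
      fun σ hσ z hz => hE.smul_mem_classPreimage hσ hz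
  refine ⟨fun a b hab => ?_⟩
  obtain ⟨x, rfl⟩ := Quotient.exists_rep a
  obtain ⟨y, rfl⟩ := Quotient.exists_rep b
  obtain ⟨D, hD, hxD, hyD⟩ := (hclass x).exists_separation hM hA hι (hclass y) (by
    rw [Set.disjoint_left]
    rintro z ⟨hz, hxz⟩ ⟨hz', hyz⟩
    exact hab (Quotient.sound (E.trans hxz (E.symm hyz))))
  -- The neighbourhoods consist of the classes contained in D and of the classes disjoint from D.
  refine ⟨{q | ∃ w : X, Quotient.mk E w = q ∧ w.1 ∈ Dᶜ}ᶜ,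
    {q | ∃ w : X, Quotient.mk E w = q ∧ w.1 ∈ D}ᶜ, ?_, ?_, ?_, ?_, ?_⟩
  · exact ((hclosed _).2 (hE.typeClosed_saturation hM hι hA hB hR hD.compl.typeClosed)).isOpen_compl
  · exact ((hclosed _).2 (hE.typeClosed_saturation hM hι hA hB hR hD.typeClosed)).isOpen_compl
  · rintro ⟨w, hw, hwD⟩
    exact hwD (hxD ⟨w.2, E.symm (Quotient.exact hw)⟩)
  · rintro ⟨w, hw, hwD⟩
    exact Set.disjoint_left.1 hyD hwD ⟨w.2, E.symm (Quotient.exact hw)⟩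
  · rw [Set.disjoint_left]
    intro q hq hq'
    obtain ⟨w, rfl⟩ := Quotient.exists_rep q
    exact hq' ⟨w, rfl, not_not.1 fun h => hq ⟨w, rfl, h⟩⟩

theorem RelInvariant.mem_classStabilizer_iff (hinv : RelInvariant E) {σ : L.Aut M} :
    σ ∈ classStabilizer E ↔ ∀ x : X, E x ⟨σ • x.1, hinv.smul_mem σ x⟩ := by
  simp only [classStabilizer, Subgroup.mem_iInf, MulAction.mem_stabilizer_iff]
  constructor
  · intro h x
    have h1 : σ • x.1 ∈ σ • relClass E x := Set.smul_mem_smul_set ⟨x.2, E.refl x⟩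
    rw [h x] at h1
    exact h1.2
  · intro h x
    ext y
    rw [Set.mem_smul_set_iff_inv_smul_mem]
    have key : ∀ (h1 : σ⁻¹ • y ∈ X) (h2 : y ∈ X), E ⟨σ⁻¹ • y, h1⟩ ⟨y, h2⟩ := by
      intro h1 h2
      have := h ⟨σ⁻¹ • y, h1⟩
      simpa only [smul_inv_smul] using this
    constructor
    · rintro ⟨h1, h2⟩
      have h3 : y ∈ X := by simpa only [smul_inv_smul] using hinv.smul_mem σ ⟨_, h1⟩
      exact ⟨h3, E.trans h2 (key h1 h3)⟩
    · rintro ⟨h1, h2⟩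
      have h3 := hinv.smul_mem σ⁻¹ ⟨y, h1⟩
      exact ⟨h3, E.trans h2 (E.symm (key h3 h1))⟩

/-- If E is the orbit relation of Γ, then every element of Γ preserves each class, so Γ ≤ Γ_E;
elements of Γ_E never leave a class. -/
theorem RelInvariant.isOrbitRel_classStabilizer (hinv : RelInvariant E) {Γ : Subgroup (L.Aut M)}
    (hΓ : IsOrbitRel E Γ) : IsOrbitRel E (classStabilizer E) := by
  intro x y
  constructor
  · intro h
    obtain ⟨γ, hγ, hxy⟩ := (hΓ x y).1 h
    exact ⟨γ, hinv.mem_classStabilizer_iff.2 fun z => (hΓ _ _).2 ⟨γ, hγ, rfl⟩, hxy⟩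
  · rintro ⟨γ, hγ, hxy⟩
    have h := hinv.mem_classStabilizer_iff.1 hγ x
    simpa only [hxy] using h

theorem RelInvariant.autf_le_classStabilizer (hinv : RelInvariant E) (hM : IsMonster L M κ)
    (hι : #ι < κ) (hbdd : RelBounded κ E) (hm : EnumeratesSmallModel κ m) :
    Autf L M κ ≤ classStabilizer E := fun _ hσ => hinv.mem_classStabilizer_iff.2 fun x =>
  hinv.rel_smul_of_lascar hM hι hbdd hm ((mem_Autf_iff hM hm).1 hσ) x

theorem RelInvariant.typeClosed_image_classStabilizer (hinv : RelInvariant E)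
    (hM : IsMonster L M κ) (hι : #ι < κ) (hbdd : RelBounded κ E) (hm : EnumeratesSmallModel κ m)
    (h : ∀ x : X, TypeClosed (entries m) (relClass E x)) :
    TypeClosed (entries m) ((fun σ : L.Aut M => σ • m) '' classStabilizer E) := by
  have hιν : #(ν ⊕ ι) < κ := by simpa using add_lt_of_lt hM.uncountable.le hm.1 hι
  have hA := mk_entries_lt hm.1 m
  have hE := hinv.classesInvariant hM hι hbdd hm
  -- Whether σx E x depends only on σm, so Γ_E m is the intersection of the P x. It ranges over all
  -- of X, which need not be small; this is harmless because each P x is type-closed over the same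
  -- set.
  let P : X → Set (∀ i, M (r i)) := fun x =>
    {n | ∃ σ : L.Aut M, σ • m = n ∧ E x ⟨σ • x.1, hinv.smul_mem σ x⟩}
  have hP : ∀ x, TypeClosed (entries m) (P x) := by
    intro x
    let f : (∀ j, M (Sum.elim r s j)) → ∀ i, M (r i) := fun z i => z (Sum.inl i)
    let Y : Set (∀ j, M (Sum.elim r s j)) :=
      {z | SameType z (concat m x.1)} ∩ {z | (fun i => (z (.inr i) : M (s i))) ∈ relClass E x}
    have hY : TypeClosed (entries m ∪ entries x.1) Y :=
      (typeClosed_sameType isTermMap_id (isTermMap_concat (isTermMap_const Set.subset_union_left)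
        (isTermMap_const Set.subset_union_right))).inter
        ((h x).preimage Set.subset_union_left isTermMap_snd)
    -- By homogeneity the pairs (σm, σx) are exactly the realizations of the type of (m, x).
    have heq : P x = f '' Y := by
      ext n
      constructor
      · rintro ⟨σ, rfl, hσ⟩
        refine ⟨σ • concat m x.1, ⟨sameType_smul σ _, ⟨hinv.smul_mem σ x, hσ⟩⟩, rfl⟩
      · rintro ⟨z, ⟨hz, hzx⟩, rfl⟩
        obtain ⟨σ, rfl⟩ := exists_smul_eq_of_sameType hM hιν hz
        exact ⟨σ, rfl, hzx.2⟩
    rw [heq]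
    refine hY.image hM hA (mk_union_lt hM.uncountable hA (mk_entries_lt hι _)) hm.1 hιν
      isTermMap_fst ?_
    intro τ hτ z hz
    have hfz : f z ∈ f '' Y := ⟨z, hz, rfl⟩
    rw [← heq] at hfz
    change τ • f z ∈ f '' Y
    rw [← heq]
    obtain ⟨σ, hσ, hσx⟩ := hfz
    refine ⟨τ * σ, by rw [← hσ, mul_smul], ?_⟩
    obtain ⟨_, h2⟩ := hE τ hτ ⟨σ • x.1, hinv.smul_mem σ x⟩
    have := E.trans hσx h2
    simpa only [mul_smul] using this
  have : (fun σ : L.Aut M => σ • m) '' classStabilizer E = typeSet m ∩ ⋂₀ Set.range P := by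
    ext n
    constructor
    · rintro ⟨σ, hσ, rfl⟩
      refine ⟨sameType_smul σ m, ?_⟩
      rintro _ ⟨x, rfl⟩
      exact ⟨σ, rfl, hinv.mem_classStabilizer_iff.1 hσ x⟩
    · rintro ⟨hn, hnP⟩
      obtain ⟨σ, rfl⟩ := exists_smul_eq_of_sameType hM hm.1 hn
      refine ⟨σ, hinv.mem_classStabilizer_iff.2 fun x => ?_, rfl⟩
      obtain ⟨τ, hτ, hτx⟩ := hnP _ ⟨x, rfl⟩
      have h1 : (σ⁻¹ * τ) • m = m := by rw [mul_smul, hτ, inv_smul_smul]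
      have h2 := hinv.rel_smul_of_smul_eq hM hι hbdd hm h1 x
      have h4 : σ • (σ⁻¹ * τ) • x.1 = τ • x.1 := by rw [← mul_smul, mul_inv_cancel_left]
      have h3 : E ⟨σ • x.1, hinv.smul_mem σ x⟩ ⟨τ • x.1, hinv.smul_mem τ x⟩ :=
        hinv.of_smul (σ := σ) rfl h4 h2
      exact E.trans hτx (E.symm h3)
  rw [this]
  refine (typeClosed_typeSet m).inter (typeClosed_sInter ?_)
  rintro _ ⟨x, rfl⟩
  exact hP x

theorem RelInvariant.typeClosed_relGraph (hinv : RelInvariant E) (hM : IsMonster L M κ)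
    (hι : #ι < κ) (hX : TypeClosed (entries m) X) (hm : EnumeratesSmallModel κ m)
    {Γ : Subgroup (L.Aut M)} (hΓ : Autf L M κ ≤ Γ)
    (hΓm : TypeClosed (entries m) ((fun σ : L.Aut M => σ • m) '' Γ)) (hE : IsOrbitRel E Γ) :
    TypeClosed (entries m) (relGraph E) := by
  have hι2 : #(ι ⊕ ι) < κ := by simpa using add_lt_of_lt hM.uncountable.le hι hι
  have hι3 : #((ι ⊕ ι) ⊕ ν) < κ := by
    rw [mk_sum, lift_id, lift_id]
    exact add_lt_of_lt hM.uncountable.le hι2 hm.1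
  have hιν : #(ν ⊕ ι) < κ := by simpa using add_lt_of_lt hM.uncountable.le hm.1 hι
  have hA := mk_entries_lt hm.1 m
  let fx : (∀ j, M (Sum.elim (Sum.elim s s) r j)) → ∀ i, M (s i) :=
    fun z i => z (Sum.inl (Sum.inl i))
  let fy : (∀ j, M (Sum.elim (Sum.elim s s) r j)) → ∀ i, M (s i) :=
    fun z i => z (Sum.inl (Sum.inr i))
  let fn : (∀ j, M (Sum.elim (Sum.elim s s) r j)) → ∀ i, M (r i) := fun z i => z (Sum.inr i)
  let f : (∀ j, M (Sum.elim (Sum.elim s s) r j)) → ∀ j, M (Sum.elim s s j) :=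
    fun z i => z (Sum.inl i)
  have hfx : IsTermMap (entries m) fx := fun i =>
    isTermMap_fst (r := Sum.elim s s) (s := r) (Sum.inl i)
  have hfy : IsTermMap (entries m) fy := fun i =>
    isTermMap_fst (r := Sum.elim s s) (s := r) (Sum.inr i)
  -- Triples (x, y, n) with x ∈ X, n ∈ Γm and (n, y) ≡ (m, x): n is a witness that y = σx for some σ
  -- ∈ Γ.
  let Y : Set (∀ j, M (Sum.elim (Sum.elim s s) r j)) :=
    (fx ⁻¹' X ∩ fn ⁻¹' ((fun σ : L.Aut M => σ • m) '' Γ)) ∩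
      {z | SameType (concat (fn z) (fy z)) (concat m (fx z))}
  have hY : TypeClosed (entries m) Y :=
    ((hX.preimage subset_rfl hfx).inter (hΓm.preimage subset_rfl isTermMap_snd)).inter
      (typeClosed_sameType (isTermMap_concat isTermMap_snd hfy)
        (isTermMap_concat (isTermMap_const subset_rfl) hfx))
  have heq : relGraph E = f '' Y := by
    ext w
    constructor
    · rintro ⟨x, y, hxy, rfl⟩
      obtain ⟨γ, hγ, hγx⟩ := (hE x y).1 hxy
      refine ⟨concat (pair x.1 y.1) (γ • m), ⟨⟨x.2, γ, hγ, rfl⟩, ?_⟩, rfl⟩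
      change SameType (concat (γ • m) y.1) (concat m x.1)
      rw [← hγx, ← smul_concat]
      exact sameType_smul γ _
    · rintro ⟨z, ⟨⟨hx, γ, hγ, hγz⟩, hz⟩, rfl⟩
      obtain ⟨σ, hσ⟩ := exists_smul_eq_of_sameType hM hιν hz
      have hσm : σ • m = fn z := funext fun i => congrFun hσ (.inl i)
      have hσx : σ • fx z = fy z := funext fun i => congrFun hσ (.inr i)
      -- The automorphism from homogeneity is only known to agree on m with some γ ∈ Γ; the two
      -- differ by an automorphism fixing m, which is Lascar strong and so lies in Γ.
      have hσΓ : σ ∈ Γ := by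
        have h1 : γ⁻¹ * σ ∈ Autf L M κ := by
          rw [mem_Autf_iff hM hm, mul_smul, hσm, ← hγz, inv_smul_smul]
        simpa using Γ.mul_mem hγ (hΓ h1)
      have hy : fy z ∈ X := hσx ▸ hinv.smul_mem σ ⟨fx z, hx⟩
      refine ⟨⟨fx z, hx⟩, ⟨fy z, hy⟩, (hE _ _).2 ⟨σ, hσΓ, hσx⟩, ?_⟩
      funext j
      rcases j with i | i <;> rfl
  rw [heq]
  refine hY.image hM hA hA hι2 hι3 isTermMap_fst ?_
  intro τ _ z hz
  have hfz : f z ∈ f '' Y := ⟨z, hz, rfl⟩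
  rw [← heq] at hfz
  change τ • f z ∈ f '' Y
  rw [← heq]
  obtain ⟨x, y, hxy, h⟩ := hfz
  refine ⟨_, _, hinv.rel_smul τ hxy, ?_⟩
  rw [h]
  funext j
  rcases j with i | i <;> rfl

end Orbital

end MSLang

theorem mainTheorem9 {L : MSLang.{u}} {M : L.Srt → Type u} [L.Str M]
    (κ : Cardinal.{u}) (hM : IsMonster L M κ)
    {ι : Type u} (hι : #ι < κ) (s : ι → L.Srt)
    (X : Set (∀ i, M (s i))) (hX : TypeDefinableOver κ ∅ X)
    (E : Setoid X) (hbdd : RelBounded κ E) (hinv : RelInvariant E)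
    (horb : ∃ Γ : Subgroup (L.Aut M), IsOrbitRel E Γ)
    {ν : Type u} (r : ν → L.Srt) (m : ∀ i, M (r i)) (hm : EnumeratesSmallModel κ m) :
    List.TFAE
      [RelTypeDefinable κ E,
       ∀ x : X, TypeDefinable κ (relClass E x),
       IsPreimageOfClosed κ m hm (classStabilizer E),
       ∃ Γ : Subgroup (L.Aut M), IsPreimageOfClosed κ m hm Γ ∧ IsOrbitRel E Γ,
       @T2Space (Quotient E) (logicTopology κ E)] := by
  have hA := mk_entries_lt hm.1 m
  have hXm : TypeClosed (entries m) X := hX.typeClosed.mono (Set.empty_subset _)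
  have hE := hinv.classesInvariant hM hι hbdd hm
  have hclass : ∀ x : X,
      TypeDefinable κ (relClass E x) ↔ TypeClosed (entries m) (relClass E x) := by
    intro x
    rw [← classPreimage_singleton]
    exact typeDefinable_classPreimage_iff hM hι hA hE _
  tfae_have 1 → 5 := by
    rintro ⟨B, hB, hR⟩
    exact hE.t2Space_of_typeClosed hM hι hA hB hXm hR.typeClosed
  tfae_have 5 → 2 := by
    intro h x
    rw [hclass, ← classPreimage_singleton, ← isClosed_logicTopology_iff hM hι hA hXm hE]
    exact @isClosed_singleton _ (logicTopology κ E) (@T2Space.t1Space _ (logicTopology κ E) h) _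
  tfae_have 2 → 3 := by
    intro h
    exact (isPreimageOfClosed_iff hM hm _).2 ⟨hinv.autf_le_classStabilizer hM hι hbdd hm,
      hinv.typeClosed_image_classStabilizer hM hι hbdd hm fun x => (hclass x).1 (h x)⟩
  tfae_have 3 → 4 := by
    intro h
    obtain ⟨Γ, hΓ⟩ := horb
    exact ⟨_, h, hinv.isOrbitRel_classStabilizer hΓ⟩
  tfae_have 4 → 1 := by
    rintro ⟨Γ, hΓ, hEΓ⟩
    obtain ⟨h1, h2⟩ := (isPreimageOfClosed_iff hM hm Γ).1 hΓ
    exact (hinv.typeClosed_relGraph hM hι hXm hm h1 h2 hEΓ).typeDefinable hM hA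
      (by simpa using add_lt_of_lt hM.uncountable.le hι hι)
  tfae_finish
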